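/- Let $d\ge 2$, $\lambda>0$, $\beta\in(0,1)$, and for $r>0$ let $Q_r:=(-r,r)^d$. Let $a$ be a measurable field of symmetric tensors on $\mathbb{R}^d$ with $\lambda|\xi|^2\le\xi\cdot a(x)\xi\le|\xi|^2$ for all $x,\xi$. Let $a_h$ be a tensor and, for $i=1,\dots,d$, let $\phi_i$ be a scalar field and $\sigma_i=\{\sigma_{ijk}\}_{j,k}$ a skew-symmetric tensor field, with components in $H^1_{loc}(\mathbb{R}^d)$, such that $$q_i:=a(e_i+\nabla\phi_i)=a_he_i+\nabla\cdot\sigma_i,\qquad(\nabla\cdot\sigma_i)_j:=\sum_k\partial_k\sigma_{ijk}.$$ Let $0<r_*\le L$ be such that the collection $(\phi,\sigma)=\{\phi_i,\sigma_{ijk}\}_{i,j,k}$ satisfies $$\frac1{2L}\Big(\frac{1}{|Q_{2L}|}\int_{Q_{2L}}\big|(\phi,\sigma)-\frac{1}{|Q_{2L}|}\int_{Q_{2L}}(\phi,\sigma)\big|^2\Big)^{1/2}\le\Big(\frac{r_*}{2L}\Big)^\beta .$$ Let $\phi^{(L)}_i,\sigma^{(L)}_{ijk}\in H^1_0(Q_{2L})$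 be the weak solutions in $Q_{2L}$ of $$-\nabla\cdot a(e_i+\nabla\phi_i^{(L)})=0,\qquad -\Delta\sigma^{(L)}_{ijk}=\partial_jq^{(L)}_{ik}-\partial_kq^{(L)}_{ij},\qquad q^{(L)}_i:=a(e_i+\nabla\phi^{(L)}_i),$$ and suppose that $$\frac1{2L}\Big(\frac{1}{|Q_{2L}|}\int_{Q_{2L}}|(\phi^{(L)},\sigma^{(L)})|^2\Big)^{1/2}\le\Big(\frac{r_*}{2L}\Big)^\beta .$$ Let $\hat\omega$ be a function supported in $Q_1$ with $\int\hat\omega=1$ and $\nabla\hat\omega$ bounded, put $\omega(x)=L^{-d}\hat\omega(x/L)$, and define $a_h^{(L)}$ by $a_h^{(L)}e_i:=\int\omega\,q_i^{(L)}$. Then $$\Big(\frac{1}{|Q_{\frac32L}|}\int_{Q_{\frac32L}}|\nabla(\phi^{(L)}-\phi)|^2\Big)^{1/2}\le C\Big(\frac{r_*}L\Big)^\beta,\qquad |a_h^{(L)}-a_h|\le C\Big(\frac{r_*}L\Big)^\beta,$$ and, provided that in the case $d\ge3$ the field $\sigma$ is in the gauge $-\Delta\sigma_{ijk}=\partial_jq_{ik}-\partial_kq_{ij}$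 on $\mathbb{R}^d$, $$\Big(\frac{1}{|Q_{L}|}\int_{Q_{L}}|\nabla(\sigma^{(L)}-\sigma)|^2\Big)^{1/2}\le C\Big(\frac{r_*}L\Big)^\beta .$$ Here $C$ depends only on $d$, $\lambda$, $\beta$ and the supremum norm of $\nabla\hat\omega$. -/

import Mathlib

open MeasureTheory Filter Topology
open scoped ContDiff NNReal ENNReal

noncomputable section

namespace DirichletProxy

/-- Euclidean space `ℝ^d`. -/
abbrev Space (d : ℕ) : Type := EuclideanSpace ℝ (Fin d)

/-- The `i`-th unit vector `e_i`. -/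
def unitVec {d : ℕ} (i : Fin d) : Space d := EuclideanSpace.single i (1 : ℝ)

/-- The centred open cube `Q_L = (-L, L)^d`. -/
def cube (d : ℕ) (L : ℝ) : Set (Space d) := {x | ∀ i, |x i| < L}

/-- `η ∈ C_c^∞(U)`. -/
structure IsTest {d : ℕ} (U : Set (Space d)) (η : Space d → ℝ) : Prop where
  smooth : ContDiff ℝ ∞ η
  compact : HasCompactSupport η
  support : tsupport η ⊆ U

/-- `u ∈ H¹_loc(ℝ^d)` with weak gradient `G`. -/
structure IsH1Loc {d : ℕ} (u : Space d → ℝ) (G : Space d → Space d) : Prop where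
  memLp : ∀ K : Set (Space d), IsCompact K → MemLp u 2 (volume.restrict K)
  memLp_grad : ∀ K : Set (Space d), IsCompact K → MemLp G 2 (volume.restrict K)
  weak_grad : ∀ η : Space d → ℝ, IsTest Set.univ η → ∀ k : Fin d,
    ∫ x, u x * gradient η x k = - ∫ x, G x k * η x

/-- `u ∈ H¹_0(U)` with weak gradient `G` on `U`: the pair `(u, G)` is a limit in `L²(U)` of pairs
`(v, ∇v)` with `v ∈ C_c^∞(U)`. Values outside `U` play no role. -/
structure IsH10 {d : ℕ} (U : Set (Space d)) (u : Space d → ℝ) (G : Space d → Space d) : Prop where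
  memLp : MemLp u 2 (volume.restrict U)
  memLp_grad : MemLp G 2 (volume.restrict U)
  approx : ∃ v : ℕ → Space d → ℝ, (∀ n, IsTest U (v n)) ∧
    Tendsto (fun n => eLpNorm (fun x => v n x - u x) 2 (volume.restrict U)) atTop (𝓝 0) ∧
    Tendsto (fun n => eLpNorm (fun x => gradient (v n) x - G x) 2 (volume.restrict U)) atTop (𝓝 0)

/-- A measurable symmetric coefficient field with `lam |ξ|² ≤ ξ · a(x) ξ ≤ |ξ|²`. -/
structure IsCoeff {d : ℕ} (lam : ℝ) (a : Space d → Space d →L[ℝ] Space d) : Prop where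
  meas : ∀ ξ, Measurable (fun x => a x ξ)
  symm : ∀ x ξ ζ, inner ℝ (a x ξ) ζ = inner ℝ ξ (a x ζ)
  upper : ∀ x ξ, inner ℝ ξ (a x ξ) ≤ ‖ξ‖ ^ 2
  lower : ∀ x ξ, lam * ‖ξ‖ ^ 2 ≤ inner ℝ ξ (a x ξ)

/-- The flux `q_i = a (e_i + ∇φ_i)`, where `G i = ∇φ_i`. -/
def flux {d : ℕ} (a : Space d → Space d →L[ℝ] Space d) (G : Fin d → Space d → Space d)
    (i : Fin d) (x : Space d) : Space d := a x (unitVec i + G i x)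

/-- Correctors `φ_i` and skew-symmetric flux correctors `σ_i` on `ℝ^d` with gradients `Gφ`, `Gσ`,
related to `a` and the tensor `ah` by `a (e_i + ∇φ_i) = ah e_i + ∇ · σ_i`,
where `(∇ · σ_i)_j = ∑ k, ∂_k σ_ijk`. -/
structure IsCorrector {d : ℕ} (a : Space d → Space d →L[ℝ] Space d) (ah : Space d →L[ℝ] Space d)
    (φ : Fin d → Space d → ℝ) (Gφ : Fin d → Space d → Space d)
    (σ : Fin d → Fin d → Fin d → Space d → ℝ)
    (Gσ : Fin d → Fin d → Fin d → Space d → Space d) : Prop where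
  h1_phi : ∀ i, IsH1Loc (φ i) (Gφ i)
  h1_sigma : ∀ i j k, IsH1Loc (σ i j k) (Gσ i j k)
  skew : ∀ i j k, ∀ᵐ x, σ i j k x = - σ i k j x
  flux_eq : ∀ i j, ∀ᵐ x, flux a Gφ i x j = ah (unitVec i) j + ∑ k, Gσ i j k x k

/-- The weak form of `-Δ σ_ijk = ∂_j q_ik - ∂_k q_ij` in an open set `U`,
where `Gσ i j k = ∇σ_ijk` and `q i j` is the `j`-th component of `q_i`. -/
def SolvesGauge {d : ℕ} (U : Set (Space d)) (q : Fin d → Space d → Space d)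
    (Gσ : Fin d → Fin d → Fin d → Space d → Space d) : Prop :=
  ∀ i j k, ∀ η : Space d → ℝ, IsTest U η →
    ∫ x in U, inner ℝ (gradient η x) (Gσ i j k x)
      = - ∫ x in U, (q i x k * gradient η x j - q i x j * gradient η x k)

/-- The Dirichlet proxies on `Q_{2L}`: `-∇ · a (e_i + ∇φL_i) = 0` and
`-Δ σL_ijk = ∂_j qL_ik - ∂_k qL_ij` in `Q_{2L}`, with zero boundary values on `∂Q_{2L}`. -/
structure IsProxy {d : ℕ} (a : Space d → Space d →L[ℝ] Space d) (L : ℝ)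
    (φL : Fin d → Space d → ℝ) (GφL : Fin d → Space d → Space d)
    (σL : Fin d → Fin d → Fin d → Space d → ℝ)
    (GσL : Fin d → Fin d → Fin d → Space d → Space d) : Prop where
  h10_phi : ∀ i, IsH10 (cube d (2 * L)) (φL i) (GφL i)
  h10_sigma : ∀ i j k, IsH10 (cube d (2 * L)) (σL i j k) (GσL i j k)
  eq_phi : ∀ i, ∀ η : Space d → ℝ, IsTest (cube d (2 * L)) η →
    ∫ x in cube d (2 * L), inner ℝ (gradient η x) (flux a GφL i x) = 0
  eq_sigma : SolvesGauge (cube d (2 * L)) (flux a GφL) GσL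

/-- A mask supported in `Q_1`, of unit integral, with gradient bounded by `M`. -/
structure IsMask {d : ℕ} (M : ℝ≥0) (mask : Space d → ℝ) : Prop where
  lipschitz : LipschitzWith M mask
  support : Function.support mask ⊆ cube d 1
  integral_eq : ∫ x, mask x = 1

/-- The proxy `ahL` of the homogenized tensor, given by
`ahL e_i = ∫ L^{-d} mask(x/L) qL_i(x) dx`. -/
def proxyTensor {d : ℕ} (a : Space d → Space d →L[ℝ] Space d) (L : ℝ) (mask : Space d → ℝ)
    (GφL : Fin d → Space d → Space d) : Space d →L[ℝ] Space d :=
  ∑ i : Fin d, (EuclideanSpace.proj i : Space d →L[ℝ] ℝ).smulRight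
    (∫ x, ((L ^ d)⁻¹ * mask (L⁻¹ • x)) • flux a GφL i x)

theorem proxyTensor_unitVec {d : ℕ} (a : Space d → Space d →L[ℝ] Space d) (L : ℝ)
    (mask : Space d → ℝ) (GφL : Fin d → Space d → Space d) (i : Fin d) :
    proxyTensor a L mask GφL (unitVec i)
      = ∫ x, ((L ^ d)⁻¹ * mask (L⁻¹ • x)) • flux a GφL i x := by
  simp [proxyTensor, unitVec]

/-- The collection `(φ, σ)` of all components `φ_i`, `σ_ijk`. -/
def joint {d : ℕ} (φ : Fin d → Space d → ℝ) (σ : Fin d → Fin d → Fin d → Space d → ℝ) :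
    Fin d ⊕ (Fin d × Fin d × Fin d) → Space d → ℝ :=
  Sum.elim φ (fun p => σ p.1 p.2.1 p.2.2)

/-- The `L²` average `(⨍_S ∑ n, |F_n|²)^{1/2}` of a finite family of fields. -/
def rms {d : ℕ} {ι V : Type} [Fintype ι] [NormedAddCommGroup V] (S : Set (Space d))
    (F : ι → Space d → V) : ℝ :=
  Real.sqrt (⨍ x in S, ∑ n, ‖F n x‖ ^ 2)

/-- The family `F - ⨍_S F`. -/
def centered {d : ℕ} {ι : Type} (S : Set (Space d)) (F : ι → Space d → ℝ) :
    ι → Space d → ℝ :=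
  fun n x => F n x - ⨍ y in S, F n y

end DirichletProxy

end

open DirichletProxy

/-!
The proof is a Caccioppoli argument. Let `w_i = φL_i - φ_i + c`. Both fluxes are weakly divergence
free in `Q_{2L}`: the one of the proxy by definition, the one of the corrector because
`q_i = a_h e_i + ∇ · σ_i` and `σ_i` is skew-symmetric
(`IsCorrector.integral_inner_flux_eq_zero`). Hence `-∇ · a ∇w_i = 0` in `Q_{2L}`, and
`caccioppoli` bounds `∇w_i` in `L²(Q_{3L/2})` by `L⁻¹ w_i` in `L²(Q_{2L})`, which the two
sublinearity hypotheses control.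

In the gauge `-Δσ_ijk = ∂_j q_ik - ∂_k q_ij`, the difference of `σL` and `σ` solves the Poisson
equation whose right-hand side is the divergence of components of `a ∇w_i`, so that a second
Caccioppoli inequality, from `Q_{3L/2}` to `Q_L`, together with the bound on `∇w_i` gives the bound
on the flux correctors. For `d = 2` the gauge equation follows from the relation between `q` and `σ`
(`IsCorrector.solvesGauge_two`).

Finally, the error of the proxy tensor is the integral of the scaled mask against
`a ∇w_i + ∇ · σ_i`. The first term is bounded by the estimate on `∇w_i`. In the second, an
integration by parts (`abs_integral_mul_grad_le`) moves the derivative to the mask, and what remains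
is the sublinearity of `σ`.

Functions in `H¹_loc` are approximated in `L²` by mollification (`IsH1Loc.isH1On`), so that all
products and integrations by parts take place on smooth functions. The constants are uniform in `L`
because cut-off functions and masks are dilations of functions at scale one.
-/

namespace DirichletProxy

variable {d : ℕ}

/-! ### Cubes and cut-off functions -/

theorem isOpen_cube (r : ℝ) : IsOpen (cube d r) := by
  have : cube d r = ⋂ i, {x : Space d | |x i| < r} := by ext; simp [cube]
  rw [this]
  exact isOpen_iInter_of_finite fun i => isOpen_lt (by fun_prop) continuous_const

theorem measurableSet_cube (r : ℝ) : MeasurableSet (cube d r) := (isOpen_cube r).measurableSet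

theorem isCompact_closedCube (r : ℝ) : IsCompact {x : Space d | ∀ i, |x i| ≤ r} := by
  have h : {x : Space d | ∀ i, |x i| ≤ r}
      = (EuclideanSpace.equiv (Fin d) ℝ).toHomeomorph ⁻¹'
        (Set.univ.pi fun _ => Set.Icc (-r) r) := by
    ext x
    simp only [Set.mem_ofPred_eq, abs_le, Set.mem_preimage, Set.mem_univ_pi, Set.mem_Icc]
    rfl
  rw [h]
  exact (Homeomorph.isCompact_preimage _).2 (isCompact_univ_pi fun _ => isCompact_Icc)

theorem cube_subset_closedCube (r : ℝ) : cube d r ⊆ {x : Space d | ∀ i, |x i| ≤ r} :=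
  fun _ hx i => (hx i).le

theorem closedCube_subset_cube {r s : ℝ} (h : r < s) :
    {x : Space d | ∀ i, |x i| ≤ r} ⊆ cube d s :=
  fun _ hx i => (hx i).trans_lt h

theorem cube_subset {r s : ℝ} (h : r ≤ s) : cube d r ⊆ cube d s :=
  fun _ hx i => (hx i).trans_le h

theorem smul_mem_cube {c r : ℝ} (hc : 0 < c) {x : Space d} :
    c⁻¹ • x ∈ cube d r ↔ x ∈ cube d (c * r) := by
  simp only [cube, Set.mem_ofPred_eq, PiLp.smul_apply, smul_eq_mul, abs_mul, abs_inv,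
    abs_of_pos hc]
  refine forall_congr' fun i => ?_
  rw [inv_mul_lt_iff₀ hc]

theorem volume_cube_lt_top (r : ℝ) : volume (cube d r) < ⊤ :=
  (measure_mono (cube_subset_closedCube r)).trans_lt (isCompact_closedCube r).measure_lt_top

instance (r : ℝ) : IsFiniteMeasure (volume.restrict (cube d r)) :=
  ⟨by simpa using volume_cube_lt_top r⟩

theorem volume_real_cube {r : ℝ} (hr : 0 < r) :
    volume.real (cube d r) = r ^ d * volume.real (cube d 1) := by
  have h : cube d r = (r⁻¹ • ·) ⁻¹' cube d 1 := by
    ext x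
    rw [Set.mem_preimage, smul_mem_cube hr, mul_one]
  rw [h, Measure.real, Measure.addHaar_preimage_smul _ (inv_ne_zero hr.ne')]
  simp only [finrank_euclideanSpace, Fintype.card_fin, inv_pow, inv_inv, abs_pow, abs_of_pos hr,
    ENNReal.toReal_mul, Measure.real]
  rw [ENNReal.toReal_ofReal (by positivity)]

theorem volume_real_cube_pos {r : ℝ} (hr : 0 < r) : 0 < volume.real (cube d r) := by
  refine ENNReal.toReal_pos ?_ (volume_cube_lt_top r).ne
  exact ((isOpen_cube r).measure_pos _ ⟨0, fun i => by simpa using hr⟩).ne'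

theorem gradient_apply {v : Space d → ℝ} {x : Space d} (k : Fin d) :
    gradient v x k = fderiv ℝ v x (unitVec k) := by
  have := inner_gradient_left (𝕜 := ℝ) (f := v) (x := x) (y := unitVec k)
  rw [← this]
  simp [unitVec, EuclideanSpace.inner_single_right, -inner_gradient_left]

theorem norm_gradient (v : Space d → ℝ) (x : Space d) : ‖gradient v x‖ = ‖fderiv ℝ v x‖ := by
  simp [gradient]

theorem continuous_gradient {v : Space d → ℝ} (hv : ContDiff ℝ ∞ v) :
    Continuous (gradient v) :=
  (InnerProductSpace.toDual ℝ (Space d)).symm.continuous.comp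
    (hv.continuous_fderiv (by simp))

theorem IsTest.mono {U V : Set (Space d)} {η : Space d → ℝ} (h : IsTest U η) (hUV : U ⊆ V) :
    IsTest V η :=
  ⟨h.smooth, h.compact, h.support.trans hUV⟩

theorem gradient_eq_zero_of_notMem {v : Space d → ℝ} {x : Space d} (hx : x ∉ tsupport v) :
    gradient v x = 0 := by
  have : fderiv ℝ v x = 0 := by
    by_contra h
    exact hx (support_fderiv_subset ℝ h)
  simp [gradient, this]

theorem tsupport_gradient_subset (v : Space d → ℝ) : tsupport (gradient v) ⊆ tsupport v := by
  refine closure_minimal (fun x hx => ?_) (isClosed_tsupport _)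
  by_contra h
  exact hx (gradient_eq_zero_of_notMem h)

theorem exists_bound_gradient {U : Set (Space d)} {η : Space d → ℝ} (h : IsTest U η) :
    ∃ K : ℝ, 0 ≤ K ∧ ∀ x, ‖gradient η x‖ ≤ K := by
  have hc : HasCompactSupport (gradient η) :=
    h.compact.of_isClosed_subset (isClosed_tsupport _) (tsupport_gradient_subset η)
  obtain ⟨K, hK⟩ := hc.exists_bound_of_continuous (continuous_gradient h.smooth)
  exact ⟨K, (norm_nonneg _).trans (hK 0), hK⟩

/-- A cut-off function for `Q_{rL}` in `Q_{sL}`, with values in `[0, 1]` and gradient at most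
`K / L`. -/
structure IsCutoff {d : ℕ} (r s K L : ℝ) (χ : Space d → ℝ) : Prop where
  test : IsTest (cube d (s * L)) χ
  nonneg : ∀ x, 0 ≤ χ x
  le_one : ∀ x, χ x ≤ 1
  eq_one : ∀ x ∈ cube d (r * L), χ x = 1
  grad_le : ∀ x, ‖gradient χ x‖ ≤ K / L

theorem exists_cutoff_unit {r s : ℝ} (hrs : r < s) :
    ∃ K : ℝ, 0 ≤ K ∧ ∃ χ : Space d → ℝ, IsCutoff r s K 1 χ := by
  obtain ⟨m, hrm, hms⟩ := exists_between hrs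
  obtain ⟨χ, hχ, hrange, hsupp, hone⟩ := exists_contMDiff_support_eq_eq_one_iff
    (modelWithCornersSelf ℝ (Space d)) (n := ⊤) (isOpen_cube (d := d) m)
    (isCompact_closedCube (d := d) r).isClosed (closedCube_subset_cube hrm)
  have hts : tsupport χ ⊆ {x : Space d | ∀ i, |x i| ≤ m} :=
    closure_minimal (hsupp.trans_subset (cube_subset_closedCube m))
      (isCompact_closedCube m).isClosed
  have htest : IsTest (cube d (s * 1)) χ :=
    ⟨hχ.contDiff, (isCompact_closedCube m).of_isClosed_subset (isClosed_tsupport _) hts,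
      by rw [mul_one]; exact hts.trans (closedCube_subset_cube hms)⟩
  obtain ⟨K, hK0, hK⟩ := exists_bound_gradient htest
  refine ⟨K, hK0, χ, htest, fun x => (hrange ⟨x, rfl⟩).1, fun x => (hrange ⟨x, rfl⟩).2,
    fun x hx => (hone x).1 (cube_subset_closedCube r (by simpa using hx)), by simpa using hK⟩

/-- The cut-off functions at scale `L` are the dilations of one at scale `1`, so that the constant
in the gradient bound does not depend on `L`. -/
theorem exists_cutoff (d : ℕ) {r s : ℝ} (hrs : r < s) :
    ∃ K : ℝ, 0 ≤ K ∧ ∀ L : ℝ, 0 < L → ∃ χ : Space d → ℝ, IsCutoff r s K L χ := by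
  obtain ⟨K, hK0, χ, hχ⟩ := exists_cutoff_unit (d := d) hrs
  refine ⟨K, hK0, fun L hL => ⟨fun x => χ (L⁻¹ • x), ?_⟩⟩
  have hL' : L⁻¹ ≠ 0 := inv_ne_zero hL.ne'
  have hts : tsupport (fun x => χ (L⁻¹ • x)) = (L⁻¹ • ·) ⁻¹' tsupport χ :=
    tsupport_comp_eq_preimage χ (Homeomorph.smulOfNeZero L⁻¹ hL')
  refine ⟨⟨hχ.test.smooth.comp (contDiff_const_smul _),
    hχ.test.compact.comp_homeomorph (Homeomorph.smulOfNeZero L⁻¹ hL'), ?_⟩,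
    fun x => hχ.nonneg _, fun x => hχ.le_one _, fun x hx => hχ.eq_one _ ?_, fun x => ?_⟩
  · rw [hts]
    intro x hx
    have := hχ.test.support hx
    rwa [mul_one, smul_mem_cube hL, mul_comm] at this
  · rwa [mul_one, smul_mem_cube hL, mul_comm]
  · have h1 : HasFDerivAt (fun x : Space d => χ (L⁻¹ • x))
        ((fderiv ℝ χ (L⁻¹ • x)).comp (L⁻¹ • ContinuousLinearMap.id ℝ (Space d))) x :=
      ((hχ.test.smooth.differentiable (by simp)) _).hasFDerivAt.comp x
        ((hasFDerivAt_id x).const_smul L⁻¹)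
    rw [norm_gradient, h1.fderiv, ContinuousLinearMap.comp_smul, ContinuousLinearMap.comp_id,
      norm_smul, norm_inv, Real.norm_of_nonneg hL.le, ← norm_gradient, div_eq_inv_mul]
    have := hχ.grad_le (L⁻¹ • x)
    rw [div_one] at this
    gcongr

/-! ### Mollification in `L²` -/

section Mollification

variable {E : Type*} [NormedAddCommGroup E]

theorem tendsto_eLpNorm_translate {f : Space d → E} (hf : MemLp f 2 volume) :
    Tendsto (fun t : Space d => eLpNorm (fun x => f (x - t) - f x) 2 volume) (𝓝 0) (𝓝 0) := by
  let F : C(Space d × Space d, Space d) := ⟨fun p => p.2 - p.1, by fun_prop⟩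
  have hmp (t : Space d) : MeasurePreserving (F.curry t) volume volume :=
    measurePreserving_sub_right volume t
  have h := (continuous_const (y := hf.toLp f)).compMeasurePreservingLp F.curry.continuous hmp
    (by simp)
  have h0 := h.tendsto 0
  rw [Lp.tendsto_Lp_iff_tendsto_eLpNorm'] at h0
  refine h0.congr fun t => eLpNorm_congr_ae ?_
  have h1 (t : Space d) : Lp.compMeasurePreserving (F.curry t) (hmp t) (hf.toLp f)
      =ᵐ[volume] fun x => f (x - t) :=
    (Lp.coeFn_compMeasurePreserving _ (hmp t)).trans
      ((hmp t).quasiMeasurePreserving.ae_eq hf.coeFn_toLp)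
  filter_upwards [h1 t, h1 0] with x hx hx0
  rw [Pi.sub_apply, hx, hx0, sub_zero]

theorem lintegral_enorm_normed (ρ : ContDiffBump (0 : Space d)) :
    ∫⁻ t, ‖ρ.normed volume t‖ₑ = 1 := by
  have h := ofReal_integral_eq_lintegral_ofReal (μ := volume) ρ.integrable_normed
    (Eventually.of_forall ρ.nonneg_normed)
  rw [ρ.integral_normed, ENNReal.ofReal_one] at h
  rw [h]
  exact lintegral_congr fun t => Real.enorm_of_nonneg (ρ.nonneg_normed t)

theorem eLpNorm_two_eq (f : Space d → E) (μ : Measure (Space d)) :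
    eLpNorm f 2 μ = (∫⁻ x, ‖f x‖ₑ ^ 2 ∂μ) ^ (2⁻¹ : ℝ) := by
  rw [eLpNorm_eq_lintegral_rpow_enorm_toReal (by norm_num) (by norm_num)]
  simp

variable [NormedSpace ℝ E]

/-- The mollification of `f` with the kernel `ρ`, normalised to unit integral. -/
noncomputable def mollify (ρ : ContDiffBump (0 : Space d)) (f : Space d → E) (x : Space d) : E :=
  ∫ t, ρ.normed volume (x - t) • f t

theorem mollify_congr_ae (ρ : ContDiffBump (0 : Space d)) {f g : Space d → E}
    (h : f =ᵐ[volume] g) : mollify ρ f = mollify ρ g := by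
  funext x
  refine integral_congr_ae ?_
  filter_upwards [h] with t ht
  rw [ht]

theorem integrable_mollify_integrand (ρ : ContDiffBump (0 : Space d)) {f : Space d → E}
    (hf : LocallyIntegrable f) (x : Space d) :
    Integrable fun t => ρ.normed volume (x - t) • f t :=
  hf.integrable_smul_left_of_hasCompactSupport
    (ρ.continuous_normed.comp (continuous_const.sub continuous_id))
    (ρ.hasCompactSupport_normed.comp_homeomorph (Homeomorph.subLeft x))

/-- Cauchy-Schwarz with respect to the probability density `ρ`. -/
theorem enorm_mollify_sub_sq_le [CompleteSpace E] (ρ : ContDiffBump (0 : Space d))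
    {f : Space d → E} (hm : StronglyMeasurable f) (hf : LocallyIntegrable f) (x : Space d) :
    ‖mollify ρ f x - f x‖ₑ ^ 2
      ≤ ∫⁻ t, ‖ρ.normed volume t‖ₑ * ‖f (x - t) - f x‖ₑ ^ 2 := by
  set r := ρ.normed volume with hr
  have hone : ∫⁻ t, ‖r t‖ₑ = 1 := lintegral_enorm_normed ρ
  have hint : Integrable fun t => r (x - t) • f t := integrable_mollify_integrand ρ hf x
  have hint' : Integrable fun t => r t • f (x - t) := by
    simpa using hint.comp_sub_left x
  have hdiff : mollify ρ f x - f x = ∫ t, r t • (f (x - t) - f x) := by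
    have h1 : mollify ρ f x = ∫ t, r t • f (x - t) := by
      rw [mollify, ← integral_sub_left_eq_self _ volume x]
      simp [hr]
    simp_rw [smul_sub]
    rw [integral_sub hint' (ρ.integrable_normed.smul_const _), h1, ρ.integral_normed_smul]
  have hmeas : AEMeasurable fun t => ‖f (x - t) - f x‖ₑ :=
    ((hm.comp_measurable (measurable_const.sub measurable_id)).sub
      stronglyMeasurable_const).enorm.aemeasurable
  have hrm : AEMeasurable fun t => ‖r t‖ₑ := ρ.continuous_normed.enorm.measurable.aemeasurable
  have hcs := ENNReal.lintegral_mul_le_Lp_mul_Lq volume Real.HolderConjugate.two_two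
    (f := fun t => ‖r t‖ₑ ^ (2⁻¹ : ℝ)) (g := fun t => ‖r t‖ₑ ^ (2⁻¹ : ℝ) * ‖f (x - t) - f x‖ₑ)
    (hrm.pow_const _) ((hrm.pow_const _).mul hmeas)
  have hhalf (y : ℝ≥0∞) : y ^ (2⁻¹ : ℝ) * y ^ (2⁻¹ : ℝ) = y := by
    rw [← ENNReal.rpow_add_of_nonneg _ _ (by norm_num) (by norm_num)]
    norm_num
  have hsq (y : ℝ≥0∞) : (y ^ (2⁻¹ : ℝ)) ^ (2 : ℝ) = y := by
    rw [← ENNReal.rpow_mul]; norm_num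
  simp only [Pi.mul_apply, ← mul_assoc, hhalf, hsq, hone, ENNReal.one_rpow, one_mul, one_div,
    ENNReal.mul_rpow_of_nonneg _ _ zero_le_two, ENNReal.rpow_two] at hcs
  calc ‖mollify ρ f x - f x‖ₑ ^ 2
      ≤ (∫⁻ t, ‖r t‖ₑ * ‖f (x - t) - f x‖ₑ) ^ 2 := by
        rw [hdiff]
        gcongr
        refine (enorm_integral_le_lintegral_enorm _).trans_eq ?_
        simp_rw [enorm_smul]
    _ ≤ _ := by
        have := ENNReal.rpow_le_rpow hcs zero_le_two
        rwa [hsq, ENNReal.rpow_two] at this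

/-- The `L²` distance of `f` to its mollification is at most the largest `L²` distance of `f` to its
translates by vectors in the support of the kernel. -/
theorem lintegral_enorm_mollify_sub_sq_le [CompleteSpace E] (ρ : ContDiffBump (0 : Space d))
    {f : Space d → E} (hm : StronglyMeasurable f) (hf : LocallyIntegrable f) {ε : ℝ≥0∞}
    (hε : ∀ t ∈ Metric.ball (0 : Space d) ρ.rOut, ∫⁻ x, ‖f (x - t) - f x‖ₑ ^ 2 ≤ ε) :
    ∫⁻ x, ‖mollify ρ f x - f x‖ₑ ^ 2 ≤ ε := by
  set r := ρ.normed volume with hr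
  have hone : ∫⁻ t, ‖r t‖ₑ = 1 := lintegral_enorm_normed ρ
  calc ∫⁻ x, ‖mollify ρ f x - f x‖ₑ ^ 2
      ≤ ∫⁻ x, ∫⁻ t, ‖r t‖ₑ * ‖f (x - t) - f x‖ₑ ^ 2 :=
        lintegral_mono fun x => enorm_mollify_sub_sq_le ρ hm hf x
    _ = ∫⁻ t, ∫⁻ x, ‖r t‖ₑ * ‖f (x - t) - f x‖ₑ ^ 2 := by
        refine lintegral_lintegral_swap (Measurable.aemeasurable ?_)
        refine (ρ.continuous_normed.enorm.measurable.comp measurable_snd).mul ?_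
        refine Measurable.pow_const ?_ 2
        exact ((hm.comp_measurable (measurable_fst.sub measurable_snd)).sub
          (hm.comp_measurable measurable_fst)).enorm
    _ ≤ ∫⁻ t, ‖r t‖ₑ * ε := by
        refine lintegral_mono fun t => ?_
        rw [lintegral_const_mul' _ _ enorm_ne_top]
        by_cases ht : t ∈ Metric.ball (0 : Space d) ρ.rOut
        · gcongr
          exact hε t ht
        · rw [← ρ.support_normed_eq (μ := volume), Function.notMem_support] at ht
          simp [hr, ht]
    _ = ε := by
        rw [lintegral_mul_const _ ρ.continuous_normed.enorm.measurable, hone, one_mul]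

theorem tendsto_eLpNorm_mollify_sub [CompleteSpace E] {f : Space d → E} (hf : MemLp f 2 volume)
    {ρ : ℕ → ContDiffBump (0 : Space d)} (hρ : Tendsto (fun n => (ρ n).rOut) atTop (𝓝 0)) :
    Tendsto (fun n => eLpNorm (fun x => mollify (ρ n) f x - f x) 2 volume) atTop (𝓝 0) := by
  have hg : MemLp (hf.1.mk f) 2 volume := hf.ae_eq hf.1.ae_eq_mk
  rw [ENNReal.tendsto_nhds_zero]
  intro ε hε
  have h := (ENNReal.tendsto_nhds_zero.1 (tendsto_eLpNorm_translate hg)) ε hε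
  obtain ⟨δ, hδ, hball⟩ := Metric.eventually_nhds_iff_ball.1 h
  filter_upwards [hρ.eventually_lt_const hδ] with n hn
  have hcongr : (fun x => mollify (ρ n) f x - f x)
      =ᵐ[volume] fun x => mollify (ρ n) (hf.1.mk f) x - hf.1.mk f x := by
    filter_upwards [hf.1.ae_eq_mk] with x hx
    rw [mollify_congr_ae (ρ n) hf.1.ae_eq_mk, ← hx]
  rw [eLpNorm_congr_ae hcongr, eLpNorm_two_eq, ENNReal.rpow_inv_le_iff two_pos]
  refine lintegral_enorm_mollify_sub_sq_le (ρ n) hf.1.stronglyMeasurable_mk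
    (hg.locallyIntegrable (by norm_num)) fun t ht => ?_
  have := hball t (Metric.ball_subset_ball hn.le ht)
  rwa [eLpNorm_two_eq, ENNReal.rpow_inv_le_iff two_pos] at this

end Mollification

/-! ### Approximation by smooth functions -/

/-- `u ∈ H¹(U)` with gradient `G`, in the sense that `(u, G)` is a limit in `L²(U)` of pairs
`(v, ∇v)` with `v` smooth on `ℝ^d`. -/
structure IsH1On (U : Set (Space d)) (u : Space d → ℝ) (G : Space d → Space d) : Prop where
  memLp : MemLp u 2 (volume.restrict U)
  memLp_grad : MemLp G 2 (volume.restrict U)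
  approx : ∃ v : ℕ → Space d → ℝ, (∀ n, ContDiff ℝ ∞ (v n)) ∧
    Tendsto (fun n => eLpNorm (fun x => v n x - u x) 2 (volume.restrict U)) atTop (𝓝 0) ∧
    Tendsto (fun n => eLpNorm (fun x => gradient (v n) x - G x) 2 (volume.restrict U)) atTop (𝓝 0)

theorem IsH10.isH1On {U : Set (Space d)} {u : Space d → ℝ} {G : Space d → Space d}
    (h : IsH10 U u G) : IsH1On U u G :=
  let ⟨v, hv, h1, h2⟩ := h.approx
  ⟨h.memLp, h.memLp_grad, v, fun n => (hv n).smooth, h1, h2⟩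

theorem gradient_sub {v w : Space d → ℝ} {x : Space d} (hv : DifferentiableAt ℝ v x)
    (hw : DifferentiableAt ℝ w x) :
    gradient (fun y => v y - w y) x = gradient v x - gradient w x := by
  simp [gradient, fderiv_fun_sub hv hw]

theorem tendsto_eLpNorm_sub_zero {E : Type*} [NormedAddCommGroup E] {μ : Measure (Space d)}
    {f g : ℕ → Space d → E} (hfm : ∀ n, AEStronglyMeasurable (f n) μ)
    (hgm : ∀ n, AEStronglyMeasurable (g n) μ)
    (hf : Tendsto (fun n => eLpNorm (f n) 2 μ) atTop (𝓝 0))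
    (hg : Tendsto (fun n => eLpNorm (g n) 2 μ) atTop (𝓝 0)) :
    Tendsto (fun n => eLpNorm (fun x => f n x - g n x) 2 μ) atTop (𝓝 0) := by
  refine tendsto_of_tendsto_of_tendsto_of_le_of_le tendsto_const_nhds
    (by simpa using hf.add hg) (fun _ => zero_le) fun n => ?_
  exact eLpNorm_sub_le (hfm n) (hgm n) (by norm_num)

theorem IsH1On.sub {U : Set (Space d)} {u w : Space d → ℝ} {G H : Space d → Space d}
    (hu : IsH1On U u G) (hw : IsH1On U w H) :
    IsH1On U (fun x => u x - w x) (fun x => G x - H x) := by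
  obtain ⟨v, hv, hv1, hv2⟩ := hu.approx
  obtain ⟨z, hz, hz1, hz2⟩ := hw.approx
  refine ⟨hu.memLp.sub hw.memLp, hu.memLp_grad.sub hw.memLp_grad, fun n x => v n x - z n x,
    fun n => (hv n).sub (hz n), ?_, ?_⟩
  · refine (tendsto_eLpNorm_sub_zero
      (fun n => (hv n).continuous.aestronglyMeasurable.sub hu.memLp.1)
      (fun n => (hz n).continuous.aestronglyMeasurable.sub hw.memLp.1) hv1 hz1).congr fun n => ?_
    congr 1
    funext x
    simp only [Pi.sub_apply]
    ring
  · refine (tendsto_eLpNorm_sub_zero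
      (fun n => (continuous_gradient (hv n)).aestronglyMeasurable.sub hu.memLp_grad.1)
      (fun n => (continuous_gradient (hz n)).aestronglyMeasurable.sub hw.memLp_grad.1)
      hv2 hz2).congr fun n => ?_
    congr 1
    funext x
    rw [gradient_sub ((hv n).differentiable (by simp) x) ((hz n).differentiable (by simp) x)]
    simp only [Pi.sub_apply]
    abel

theorem IsH1On.const {r : ℝ} (c : ℝ) : IsH1On (cube d r) (fun _ => c) 0 := by
  refine ⟨memLp_const c, MemLp.zero, fun _ _ => c, fun _ => contDiff_const, ?_, ?_⟩
  · simp
  · simp [gradient]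

theorem IsH1On.sub_const {r : ℝ} {u : Space d → ℝ} {G : Space d → Space d}
    (hu : IsH1On (cube d r) u G) (c : ℝ) : IsH1On (cube d r) (fun x => u x - c) G := by
  simpa using hu.sub (IsH1On.const c)

theorem IsH1Loc.memLp_cube {u : Space d → ℝ} {G : Space d → Space d} (h : IsH1Loc u G) (r : ℝ) :
    MemLp u 2 (volume.restrict (cube d r)) :=
  (h.memLp _ (isCompact_closedCube r)).mono_measure
    (Measure.restrict_mono (cube_subset_closedCube r) le_rfl)

theorem IsH1Loc.memLp_grad_cube {u : Space d → ℝ} {G : Space d → Space d} (h : IsH1Loc u G)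
    (r : ℝ) : MemLp G 2 (volume.restrict (cube d r)) :=
  (h.memLp_grad _ (isCompact_closedCube r)).mono_measure
    (Measure.restrict_mono (cube_subset_closedCube r) le_rfl)

theorem locallyIntegrable_of_memLp {E : Type*} [NormedAddCommGroup E] {f : Space d → E}
    (h : ∀ K : Set (Space d), IsCompact K → MemLp f 2 (volume.restrict K)) :
    LocallyIntegrable f :=
  locallyIntegrable_iff.2 fun K hK => by
    have : IsFiniteMeasure (volume.restrict K) := ⟨by simpa using hK.measure_lt_top⟩
    exact (h K hK).integrable (by norm_num)

theorem mollify_eq_convolution {E : Type*} [NormedAddCommGroup E] [NormedSpace ℝ E]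
    (ρ : ContDiffBump (0 : Space d)) (f : Space d → E) :
    mollify ρ f = convolution (ρ.normed volume) f (ContinuousLinearMap.lsmul ℝ ℝ) volume := by
  funext x
  rw [convolution_eq_swap]
  rfl

theorem contDiff_mollify (ρ : ContDiffBump (0 : Space d)) {u : Space d → ℝ}
    (hu : LocallyIntegrable u) : ContDiff ℝ ∞ (mollify ρ u) := by
  rw [mollify_eq_convolution]
  exact ρ.hasCompactSupport_normed.contDiff_convolution_left _ ρ.contDiff_normed hu

/-- Mollification commutes with weak gradients: `t ↦ ρ (x - t)` is a test function. -/
theorem gradient_mollify (ρ : ContDiffBump (0 : Space d)) {u : Space d → ℝ}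
    {G : Space d → Space d} (h : IsH1Loc u G) (x : Space d) :
    gradient (mollify ρ u) x = mollify ρ G x := by
  have hu := locallyIntegrable_of_memLp h.memLp
  have hG := locallyIntegrable_of_memLp h.memLp_grad
  set r := ρ.normed volume with hr
  have hrs : ContDiff ℝ ∞ r := ρ.contDiff_normed
  have hrc : HasCompactSupport r := ρ.hasCompactSupport_normed
  ext k
  have hd := hrc.hasFDerivAt_convolution_left (ContinuousLinearMap.lsmul ℝ ℝ)
    (hrs.of_le (by simp)) hu x
  have hex := (hrc.fderiv ℝ).convolutionExists_left
    ((ContinuousLinearMap.lsmul ℝ ℝ).precompL (Space d)) (hrs.continuous_fderiv (by simp)) hu x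
  have h1 : gradient (mollify ρ u) x k = ∫ t, fderiv ℝ r (x - t) (unitVec k) * u t := by
    rw [gradient_apply, mollify_eq_convolution, hd.fderiv, convolution_eq_swap,
      ContinuousLinearMap.integral_apply hex.integrable_swap]
    rfl
  have h2 : mollify ρ G x k = ∫ t, r (x - t) * G t k := by
    have := (EuclideanSpace.proj k : Space d →L[ℝ] ℝ).integral_comp_comm
      (integrable_mollify_integrand ρ hG x)
    exact this.symm
  have htest : IsTest Set.univ fun t => r (x - t) :=
    ⟨hrs.comp (contDiff_const.sub contDiff_id), hrc.comp_homeomorph (Homeomorph.subLeft x),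
      Set.subset_univ _⟩
  have hgrad (t : Space d) :
      gradient (fun t => r (x - t)) t k = - fderiv ℝ r (x - t) (unitVec k) := by
    have hd : HasFDerivAt (fun t => r (x - t))
        ((fderiv ℝ r (x - t)).comp (-ContinuousLinearMap.id ℝ (Space d))) t :=
      ((hrs.differentiable (by simp)) _).hasFDerivAt.comp t ((hasFDerivAt_id t).const_sub x)
    rw [gradient_apply, hd.fderiv]
    simp
  have hw := h.weak_grad _ htest k
  simp only [hgrad, mul_neg, integral_neg, neg_inj] at hw
  rw [h1, h2]
  simpa only [mul_comm] using hw

theorem abs_apply_le_norm (x : Space d) (i : Fin d) : |x i| ≤ ‖x‖ := by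
  simpa using PiLp.norm_apply_le x i

theorem tendsto_eLpNorm_mollify_sub_cube {E : Type*} [NormedAddCommGroup E] [NormedSpace ℝ E]
    [CompleteSpace E] {f : Space d → E}
    (hf : ∀ K : Set (Space d), IsCompact K → MemLp f 2 (volume.restrict K))
    {ρ : ℕ → ContDiffBump (0 : Space d)} (hρ : Tendsto (fun n => (ρ n).rOut) atTop (𝓝 0)) (r : ℝ) :
    Tendsto (fun n => eLpNorm (fun x => mollify (ρ n) f x - f x) 2
      (volume.restrict (cube d r))) atTop (𝓝 0) := by
  set K : Set (Space d) := {x | ∀ i, |x i| ≤ r + 1} with hK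
  have hKm : MeasurableSet K := (isCompact_closedCube (r + 1)).measurableSet
  have hfK : MemLp (K.indicator f) 2 volume :=
    (memLp_indicator_iff_restrict hKm).2 (hf K (isCompact_closedCube (r + 1)))
  refine tendsto_of_tendsto_of_tendsto_of_le_of_le' tendsto_const_nhds
    (tendsto_eLpNorm_mollify_sub hfK hρ) (Eventually.of_forall fun _ => zero_le) ?_
  filter_upwards [hρ.eventually_lt_const one_pos] with n hn
  refine le_trans (le_of_eq ?_) (eLpNorm_mono_measure (fun x => mollify (ρ n) (K.indicator f) x
    - K.indicator f x) (Measure.restrict_le_self (s := cube d r)))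
  refine eLpNorm_congr_ae ((ae_restrict_iff' (measurableSet_cube r)).2 (Eventually.of_forall ?_))
  -- within distance one of the cube, `f` and its truncation agree
  intro x hx
  have hxK : x ∈ K := fun i => (hx i).le.trans (by linarith)
  have hconv : mollify (ρ n) f x = mollify (ρ n) (K.indicator f) x := by
    refine integral_congr_ae (Eventually.of_forall fun t => ?_)
    by_cases ht : t ∈ K
    · simp [ht]
    · have h0 : (ρ n).normed volume (x - t) = 0 := by
        rw [← Function.notMem_support, (ρ n).support_normed_eq, mem_ball_zero_iff, not_lt]
        by_contra hlt
        refine ht fun i => ?_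
        have h1 := abs_apply_le_norm (x - t) i
        have h2 := abs_sub_abs_le_abs_sub (t i) (x i)
        rw [abs_sub_comm] at h2
        have h3 := hx i
        simp only [PiLp.sub_apply] at h1
        linarith
      simp [h0]
  simp [hconv, Set.indicator_of_mem hxK]

/-- Mollifications of a function on `ℝ^d` approximate it up to the boundary of a cube, so that no
extension is needed. -/
theorem IsH1Loc.isH1On {u : Space d → ℝ} {G : Space d → Space d} (h : IsH1Loc u G) (r : ℝ) :
    IsH1On (cube d r) u G := by
  let ρ (n : ℕ) : ContDiffBump (0 : Space d) :=
    ⟨1 / (n + 1) / 2, 1 / (n + 1), by positivity, half_lt_self (by positivity)⟩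
  have hρ : Tendsto (fun n => (ρ n).rOut) atTop (𝓝 0) := tendsto_one_div_add_atTop_nhds_zero_nat
  refine ⟨h.memLp_cube r, h.memLp_grad_cube r, fun n => mollify (ρ n) u,
    fun n => contDiff_mollify _ (locallyIntegrable_of_memLp h.memLp),
    tendsto_eLpNorm_mollify_sub_cube h.memLp hρ r, ?_⟩
  simp_rw [gradient_mollify _ h]
  exact tendsto_eLpNorm_mollify_sub_cube h.memLp_grad hρ r

/-! ### Integrals of products in `L²` -/

section Pairing

variable {E : Type*} [NormedAddCommGroup E] [InnerProductSpace ℝ E] {μ : Measure (Space d)}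

theorem integrable_inner_of_memLp {F G : Space d → E} (hF : MemLp F 2 μ) (hG : MemLp G 2 μ) :
    Integrable (fun x => inner ℝ (F x) (G x)) μ := by
  refine memLp_one_iff_integrable.1 ⟨hF.1.inner hG.1, ?_⟩
  refine (eLpNorm_le_eLpNorm_mul_eLpNorm_of_nnnorm (p := 2) (q := 2) hF.1 hG.1
    (fun a b => inner ℝ a b) 1 (Eventually.of_forall fun x => ?_)).trans_lt ?_
  · simpa using nnnorm_inner_le_nnnorm (𝕜 := ℝ) (F x) (G x)
  · simpa using ENNReal.mul_lt_top hF.2 hG.2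

theorem tendsto_integral_inner {v : ℕ → Space d → E} {V F : Space d → E}
    (hv : ∀ n, MemLp (v n) 2 μ) (hV : MemLp V 2 μ) (hF : MemLp F 2 μ)
    (h : Tendsto (fun n => eLpNorm (fun x => v n x - V x) 2 μ) atTop (𝓝 0)) :
    Tendsto (fun n => ∫ x, inner ℝ (v n x) (F x) ∂μ) atTop (𝓝 (∫ x, inner ℝ (V x) (F x) ∂μ)) := by
  refine tendsto_integral_of_L1' _ (integrable_inner_of_memLp hV hF).1
    (Eventually.of_forall fun n => integrable_inner_of_memLp (hv n) hF) ?_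
  have hlim : Tendsto (fun n => eLpNorm (fun x => v n x - V x) 2 μ * eLpNorm F 2 μ) atTop (𝓝 0) := by
    simpa using ENNReal.Tendsto.mul_const h (Or.inr hF.2.ne)
  refine tendsto_of_tendsto_of_tendsto_of_le_of_le tendsto_const_nhds hlim (fun _ => zero_le)
    fun n => ?_
  have hle := eLpNorm_le_eLpNorm_mul_eLpNorm_of_nnnorm (p := 2) (q := 2) (r := 1)
    ((hv n).1.sub hV.1) hF.1
    (fun a b => inner ℝ a b) 1 (Eventually.of_forall fun x => by
      simpa using nnnorm_inner_le_nnnorm (𝕜 := ℝ) ((v n - V) x) (F x))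
  simp only [Pi.sub_apply, ENNReal.coe_one, one_mul, inner_sub_left] at hle
  exact hle

end Pairing

/-! ### The Caccioppoli inequality -/

section Coeff

variable {lam : ℝ} {a : Space d → Space d →L[ℝ] Space d}

/-- `|a ξ| ≤ |ξ|`: test the positivity of `a` with the vector `ξ - a ξ`. -/
theorem IsCoeff.norm_le (ha : IsCoeff lam a) (hlam : 0 < lam) (x ξ : Space d) :
    ‖a x ξ‖ ≤ ‖ξ‖ := by
  have h1 := ha.lower x (ξ - a x ξ)
  have h2 : 0 ≤ lam * ‖ξ - a x ξ‖ ^ 2 := by positivity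
  have h3 := ha.upper x ξ
  have h4 := ha.upper x (a x ξ)
  have h5 := ha.symm x ξ (a x ξ)
  have h6 : inner ℝ (ξ - a x ξ) (a x (ξ - a x ξ))
      = inner ℝ ξ (a x ξ) - 2 * ‖a x ξ‖ ^ 2 + inner ℝ (a x ξ) (a x (a x ξ)) := by
    rw [map_sub, inner_sub_left, inner_sub_right, inner_sub_right, ← h5,
      real_inner_self_eq_norm_sq]
    ring
  exact (sq_le_sq₀ (norm_nonneg _) (norm_nonneg _)).1 (by linarith)

theorem eq_sum_unitVec (ξ : Space d) : ξ = ∑ i, ξ i • unitVec i := by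
  ext j
  simp [unitVec, Finset.sum_apply, Pi.single_apply]

theorem IsCoeff.aestronglyMeasurable (ha : IsCoeff lam a) {μ : Measure (Space d)}
    {W : Space d → Space d} (hW : AEStronglyMeasurable W μ) :
    AEStronglyMeasurable (fun x => a x (W x)) μ := by
  have h : (fun x => a x (W x)) = fun x => ∑ i, W x i • a x (unitVec i) := by
    funext x
    conv_lhs => rw [eq_sum_unitVec (W x)]
    simp
  rw [h]
  refine Finset.aestronglyMeasurable_fun_sum _ fun i _ => ?_
  have hi : AEStronglyMeasurable (fun x => W x i) μ :=
    (EuclideanSpace.proj i : Space d →L[ℝ] ℝ).continuous.comp_aestronglyMeasurable hW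
  exact hi.smul (ha.meas _).aestronglyMeasurable

theorem IsCoeff.memLp (ha : IsCoeff lam a) (hlam : 0 < lam) {μ : Measure (Space d)}
    {W : Space d → Space d} (hW : MemLp W 2 μ) : MemLp (fun x => a x (W x)) 2 μ :=
  hW.mono (ha.aestronglyMeasurable hW.1) (Eventually.of_forall fun x => ha.norm_le hlam x _)

theorem isCoeff_id : IsCoeff 1 fun _ : Space d => ContinuousLinearMap.id ℝ (Space d) where
  meas _ := measurable_const
  symm _ _ _ := rfl
  upper _ ξ := by simp
  lower _ ξ := by simp

end Coeff

theorem memLp_cube_of_continuous {E : Type*} [NormedAddCommGroup E] {f : Space d → E}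
    [SecondCountableTopologyEither (Space d) E]
    (hf : Continuous f) (r : ℝ) : MemLp f 2 (volume.restrict (cube d r)) := by
  obtain ⟨C, hC⟩ := (isCompact_closedCube r).exists_bound_of_continuousOn hf.continuousOn
  refine MemLp.of_bound hf.aestronglyMeasurable C ?_
  exact (ae_restrict_iff' (measurableSet_cube r)).2
    (Eventually.of_forall fun x hx => hC x (cube_subset_closedCube r hx))

theorem IsTest.sq_mul {U : Set (Space d)} {χ v : Space d → ℝ} (hχ : IsTest U χ)
    (hv : ContDiff ℝ ∞ v) : IsTest U fun x => χ x ^ 2 * v x := by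
  have hs : tsupport (fun x => χ x ^ 2 * v x) ⊆ tsupport χ := by
    refine closure_mono fun x hx => ?_
    contrapose! hx
    simp [Function.notMem_support.1 hx]
  exact ⟨(hχ.smooth.pow 2).mul hv, hχ.compact.of_isClosed_subset (isClosed_tsupport _) hs,
    hs.trans hχ.support⟩

theorem gradient_sq_mul {χ v : Space d → ℝ} {x : Space d} (hχ : DifferentiableAt ℝ χ x)
    (hv : DifferentiableAt ℝ v x) :
    gradient (fun y => χ y ^ 2 * v y) x
      = v x • (2 * χ x) • gradient χ x + χ x ^ 2 • gradient v x := by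
  ext k
  have := (hχ.hasFDerivAt.pow 2).mul hv.hasFDerivAt
  rw [PiLp.add_apply, PiLp.smul_apply, PiLp.smul_apply, PiLp.smul_apply]
  simp only [gradient_apply]
  change fderiv ℝ ((fun y => χ y ^ 2) * v) x _ = _
  rw [this.fderiv]
  simp [add_comm]

/-- A field that is weakly divergence free in `Q_R` is orthogonal to `∇(χ² w)`, which is written out
here: approximate `w` by smooth `v n` and test with `χ² v n`. -/
theorem integral_inner_cutoff_eq_zero {r s K L R : ℝ} {χ w : Space d → ℝ}
    {W F : Space d → Space d} (hχ : IsCutoff r s K L χ) (hsR : s * L ≤ R)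
    (hw : IsH1On (cube d R) w W) (hF : MemLp F 2 (volume.restrict (cube d R)))
    (heq : ∀ η, IsTest (cube d R) η → ∫ x in cube d R, inner ℝ (gradient η x) (F x) = 0) :
    ∫ x in cube d R, inner ℝ (w x • (2 * χ x) • gradient χ x + χ x ^ 2 • W x) (F x) = 0 := by
  obtain ⟨v, hv, hv1, hv2⟩ := hw.approx
  set μ := volume.restrict (cube d R)
  have hχs := hχ.test.smooth
  have hχd (x) : DifferentiableAt ℝ χ x := hχs.differentiable (by simp) x
  have hχ1 (x) : ‖χ x‖ ≤ 1 := by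
    rw [Real.norm_of_nonneg (hχ.nonneg x)]
    exact hχ.le_one x
  have hF1 : MemLp (fun x => inner ℝ ((2 * χ x) • gradient χ x) (F x)) 2 μ := by
    refine hF.of_le_mul (c := 2 * (K / L)) ?_ (Eventually.of_forall fun x => ?_)
    · exact ((continuous_const.mul hχs.continuous).smul
        (continuous_gradient hχs)).aestronglyMeasurable.inner hF.1
    · refine (norm_inner_le_norm _ _).trans ?_
      rw [norm_smul, norm_mul, Real.norm_ofNat]
      have := hχ1 x
      have := hχ.grad_le x
      have h0 := norm_nonneg (gradient χ x)
      refine mul_le_mul_of_nonneg_right ?_ (norm_nonneg _)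
      calc 2 * ‖χ x‖ * ‖gradient χ x‖ ≤ 2 * 1 * (K / L) := by gcongr
        _ = _ := by ring
  have hF2 : MemLp (fun x => χ x ^ 2 • F x) 2 μ := by
    refine hF.mono ((hχs.continuous.pow 2).aestronglyMeasurable.smul hF.1)
      (Eventually.of_forall fun x => ?_)
    rw [norm_smul, norm_pow]
    exact mul_le_of_le_one_left (norm_nonneg _) (pow_le_one₀ (norm_nonneg _) (hχ1 x))
  have hsplit {z : Space d → ℝ} {Z : Space d → Space d} (hz : MemLp z 2 μ) (hZ : MemLp Z 2 μ) :
      ∫ x, inner ℝ (z x • (2 * χ x) • gradient χ x + χ x ^ 2 • Z x) (F x) ∂μ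
        = ∫ x, inner ℝ (z x) (inner ℝ ((2 * χ x) • gradient χ x) (F x)) ∂μ
          + ∫ x, inner ℝ (Z x) (χ x ^ 2 • F x) ∂μ := by
    rw [← integral_add (integrable_inner_of_memLp hz hF1) (integrable_inner_of_memLp hZ hF2)]
    refine integral_congr_ae (Eventually.of_forall fun x => ?_)
    simp only [inner_add_left, inner_smul_left, inner_smul_right, RCLike.inner_apply]
    simp
    ring
  have hvm (n) : MemLp (v n) 2 μ := memLp_cube_of_continuous (hv n).continuous R
  have hvg (n) : MemLp (gradient (v n)) 2 μ :=
    memLp_cube_of_continuous (continuous_gradient (hv n)) R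
  rw [hsplit hw.memLp hw.memLp_grad]
  refine tendsto_nhds_unique ((tendsto_integral_inner hvm hw.memLp hF1 hv1).add
    (tendsto_integral_inner hvg hw.memLp_grad hF2 hv2)) (tendsto_const_nhds.congr fun n => ?_)
  rw [← hsplit (hvm n) (hvg n)]
  have := heq _ ((hχ.test.mono (cube_subset hsR)).sq_mul (hv n))
  simp_rw [gradient_sq_mul (hχd _) ((hv n).differentiable (by simp) _)] at this
  exact this.symm

/-- The pointwise absorption step of the Caccioppoli inequality. Here `t` is the cut-off and `k` a
bound on its gradient, `ξ` and `f` are the sizes of the gradient and of the right-hand side, and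
`P`, `Q`, `R`, `S` stand for the inner products that occur. -/
theorem young_inequality {lam t ξ k w f P Q R S : ℝ} (hlam : 0 < lam)
    (hP : lam * ξ ^ 2 ≤ P) (hQ : |Q| ≤ k * ξ) (hR : |R| ≤ k * f) (hS : |S| ≤ ξ * f) :
    lam / 2 * (t ^ 2 * ξ ^ 2) ≤ (w * (2 * t * Q) + t ^ 2 * P - (w * (2 * t * R) + t ^ 2 * S))
      + ((4 / lam + 1) * (k ^ 2 * w ^ 2) + (1 / lam + 1) * (t ^ 2 * f ^ 2)) := by
  have h1 : |w * (2 * t * Q)| ≤ lam / 4 * (t ^ 2 * ξ ^ 2) + 4 / lam * (k ^ 2 * w ^ 2) := by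
    have hsq : 0 ≤ lam / 4 * (|t| * ξ - 4 / lam * (|w| * k)) ^ 2 := by positivity
    have hexp : lam / 4 * (|t| * ξ - 4 / lam * (|w| * k)) ^ 2
        = lam / 4 * (|t| ^ 2 * ξ ^ 2) + 4 / lam * (k ^ 2 * |w| ^ 2) - |w| * (2 * |t| * (k * ξ)) := by
      field_simp
      ring
    rw [sq_abs, sq_abs] at hexp
    have hle : |w * (2 * t * Q)| ≤ |w| * (2 * |t| * (k * ξ)) := by
      rw [abs_mul, abs_mul, abs_mul, abs_two]
      gcongr
    linarith
  have h2 : |w * (2 * t * R)| ≤ k ^ 2 * w ^ 2 + t ^ 2 * f ^ 2 := by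
    have hsq : 0 ≤ (|t| * f - |w| * k) ^ 2 := by positivity
    have hexp : (|t| * f - |w| * k) ^ 2
        = k ^ 2 * |w| ^ 2 + |t| ^ 2 * f ^ 2 - |w| * (2 * |t| * (k * f)) := by ring
    rw [sq_abs, sq_abs] at hexp
    have hle : |w * (2 * t * R)| ≤ |w| * (2 * |t| * (k * f)) := by
      rw [abs_mul, abs_mul, abs_mul, abs_two]
      gcongr
    linarith
  have h3 : |t ^ 2 * S| ≤ lam / 4 * (t ^ 2 * ξ ^ 2) + 1 / lam * (t ^ 2 * f ^ 2) := by
    have hsq : 0 ≤ lam / 4 * t ^ 2 * (ξ - 2 / lam * f) ^ 2 := by positivity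
    have hexp : lam / 4 * t ^ 2 * (ξ - 2 / lam * f) ^ 2
        = lam / 4 * (t ^ 2 * ξ ^ 2) + 1 / lam * (t ^ 2 * f ^ 2) - t ^ 2 * (ξ * f) := by
      field_simp
      ring
    have hle : |t ^ 2 * S| ≤ t ^ 2 * (ξ * f) := by
      rw [abs_mul, abs_of_nonneg (sq_nonneg t)]
      gcongr
    linarith
  have h4 : t ^ 2 * (lam * ξ ^ 2) ≤ t ^ 2 * P := by gcongr
  linarith [neg_abs_le (w * (2 * t * Q)), le_abs_self (w * (2 * t * R)), le_abs_self (t ^ 2 * S)]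

/-- The Caccioppoli inequality for `-∇ · a ∇w = -∇ · f` in `Q_R`: test with `χ² w`. -/
theorem caccioppoli {lam r s K L R : ℝ} (hlam : 0 < lam) {a : Space d → Space d →L[ℝ] Space d}
    (ha : IsCoeff lam a) {χ w : Space d → ℝ} {W f : Space d → Space d}
    (hχ : IsCutoff r s K L χ) (hrs : r * L ≤ s * L) (hsR : s * L ≤ R)
    (hw : IsH1On (cube d R) w W) (hf : MemLp f 2 (volume.restrict (cube d R)))
    (heq : ∀ η, IsTest (cube d R) η → ∫ x in cube d R, inner ℝ (gradient η x) (a x (W x))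
      = ∫ x in cube d R, inner ℝ (gradient η x) (f x)) :
    lam / 2 * ∫ x in cube d (r * L), ‖W x‖ ^ 2
      ≤ (4 / lam + 1) * (K / L) ^ 2 * (∫ x in cube d R, w x ^ 2)
        + (1 / lam + 1) * ∫ x in cube d (s * L), ‖f x‖ ^ 2 := by
  set μ := volume.restrict (cube d R) with hμ
  have haW := ha.memLp hlam hw.memLp_grad
  have hF : MemLp (fun x => a x (W x) - f x) 2 μ := haW.sub hf
  have hgr {η} (hη : IsTest (cube d R) η) : MemLp (gradient η) 2 μ :=
    memLp_cube_of_continuous (continuous_gradient hη.smooth) R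
  have hzero := integral_inner_cutoff_eq_zero hχ hsR hw hF fun η hη => by
    simp_rw [inner_sub_right]
    rw [integral_sub (integrable_inner_of_memLp (hgr hη) haW)
      (integrable_inner_of_memLp (hgr hη) hf), heq η hη, sub_self]
  have hχc := hχ.test.smooth.continuous
  have hχ1 (x) : χ x ^ 2 ≤ 1 := pow_le_one₀ (hχ.nonneg x) (hχ.le_one x)
  have hW2 : Integrable (fun x => ‖W x‖ ^ 2) μ :=
    (memLp_two_iff_integrable_sq_norm hw.memLp_grad.1).1 hw.memLp_grad
  have hf2 : Integrable (fun x => ‖f x‖ ^ 2) μ := (memLp_two_iff_integrable_sq_norm hf.1).1 hf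
  have hw2 : Integrable (fun x => w x ^ 2) μ := hw.memLp.integrable_sq
  have hmul {g : Space d → ℝ} (hg : Integrable g μ) : Integrable (fun x => χ x ^ 2 * g x) μ :=
    hg.bdd_mul (c := 1) (hχc.pow 2).aestronglyMeasurable (Eventually.of_forall fun x => by
      rw [Real.norm_of_nonneg (sq_nonneg _)]; exact hχ1 x)
  have hVF : Integrable (fun x => inner ℝ (w x • (2 * χ x) • gradient χ x + χ x ^ 2 • W x)
      (a x (W x) - f x)) μ := by
    refine integrable_inner_of_memLp (MemLp.add ?_ ?_) hF
    · refine hw.memLp.of_le_mul (c := 2 * (K / L)) (hw.memLp.1.smul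
        ((continuous_const.mul hχc).smul
          (continuous_gradient hχ.test.smooth)).aestronglyMeasurable)
        (Eventually.of_forall fun x => ?_)
      rw [norm_smul, norm_smul, norm_mul, Real.norm_ofNat, Real.norm_of_nonneg (hχ.nonneg x),
        mul_comm]
      have := hχ.le_one x
      have := hχ.grad_le x
      have h0 := norm_nonneg (gradient χ x)
      refine mul_le_mul_of_nonneg_right ?_ (norm_nonneg _)
      calc 2 * χ x * ‖gradient χ x‖ ≤ 2 * 1 * (K / L) := by gcongr
        _ = _ := by ring
    · refine hw.memLp_grad.mono ((hχc.pow 2).aestronglyMeasurable.smul hw.memLp_grad.1)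
        (Eventually.of_forall fun x => ?_)
      rw [norm_smul, Real.norm_of_nonneg (sq_nonneg _)]
      exact mul_le_of_le_one_left (norm_nonneg _) (hχ1 x)
  have hpt (x : Space d) : lam / 2 * (χ x ^ 2 * ‖W x‖ ^ 2)
      ≤ inner ℝ (w x • (2 * χ x) • gradient χ x + χ x ^ 2 • W x) (a x (W x) - f x)
        + ((4 / lam + 1) * ((K / L) ^ 2 * w x ^ 2) + (1 / lam + 1) * (χ x ^ 2 * ‖f x‖ ^ 2)) := by
    have hk := hχ.grad_le x
    have hk0 : 0 ≤ K / L := (norm_nonneg _).trans hk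
    have := young_inequality (t := χ x) (w := w x) hlam (ha.lower x (W x))
      (Q := inner ℝ (gradient χ x) (a x (W x))) (R := inner ℝ (gradient χ x) (f x))
      (S := inner ℝ (W x) (f x)) (k := K / L) (f := ‖f x‖)
      ((abs_real_inner_le_norm _ _).trans (by gcongr; exact ha.norm_le hlam x _))
      ((abs_real_inner_le_norm _ _).trans (by gcongr)) (abs_real_inner_le_norm _ _)
    simp only [inner_sub_right, inner_add_left, inner_smul_left, RCLike.conj_to_real]
    linarith
  have hB1 : Integrable (fun x => (4 / lam + 1) * ((K / L) ^ 2 * w x ^ 2)) μ :=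
    (hw2.const_mul _).const_mul _
  have hB2 : Integrable (fun x => (1 / lam + 1) * (χ x ^ 2 * ‖f x‖ ^ 2)) μ :=
    (hmul hf2).const_mul _
  have hB : Integrable (fun x => (4 / lam + 1) * ((K / L) ^ 2 * w x ^ 2)
      + (1 / lam + 1) * (χ x ^ 2 * ‖f x‖ ^ 2)) μ := hB1.add hB2
  have hint := integral_mono ((hmul hW2).const_mul (lam / 2)) (hVF.add hB) hpt
  simp only [Pi.add_apply] at hint
  rw [integral_add hVF hB, hzero, zero_add, integral_add hB1 hB2] at hint
  simp only [integral_const_mul] at hint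
  have h1 : ∫ x in cube d (r * L), ‖W x‖ ^ 2 ≤ ∫ x, χ x ^ 2 * ‖W x‖ ^ 2 ∂μ := by
    rw [setIntegral_congr_fun (g := fun x => χ x ^ 2 * ‖W x‖ ^ 2) (measurableSet_cube _)
      fun x hx => by simp [hχ.eq_one x hx]]
    exact setIntegral_mono_set (hmul hW2) (Eventually.of_forall fun x => by positivity)
      (cube_subset (hrs.trans hsR)).eventuallyLE
  have h2 : ∫ x, χ x ^ 2 * ‖f x‖ ^ 2 ∂μ ≤ ∫ x in cube d (s * L), ‖f x‖ ^ 2 := by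
    rw [setIntegral_eq_of_subset_of_forall_sdiff_eq_zero (measurableSet_cube R)
      (cube_subset hsR) fun x hx => ?_]
    · have hle : volume.restrict (cube d (s * L)) ≤ μ :=
        Measure.restrict_mono (cube_subset hsR) le_rfl
      exact integral_mono ((hmul hf2).mono_measure hle) (hf2.mono_measure hle)
        fun x => mul_le_of_le_one_left (by positivity) (hχ1 x)
    · have : χ x = 0 := by
        by_contra h
        exact hx.2 (hχ.test.support (subset_tsupport _ h))
      simp [this]
  calc _ ≤ lam / 2 * ∫ x, χ x ^ 2 * ‖W x‖ ^ 2 ∂μ := by gcongr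
    _ ≤ _ := hint
    _ ≤ _ := by
      rw [mul_assoc]
      gcongr

/-! ### Weak equations for the correctors -/

theorem IsTest.partial {U : Set (Space d)} {η : Space d → ℝ} (h : IsTest U η) (j : Fin d) :
    IsTest U fun x => gradient η x j := by
  have hs : tsupport (fun x => gradient η x j) ⊆ tsupport η := by
    refine closure_minimal (fun x hx => ?_) (isClosed_tsupport _)
    by_contra hn
    exact hx (by simp [gradient_eq_zero_of_notMem hn])
  refine ⟨?_, h.compact.of_isClosed_subset (isClosed_tsupport _) hs, hs.trans h.support⟩
  simp_rw [gradient_apply]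
  exact (h.smooth.fderiv_right (m := ∞) (by simp)).clm_apply contDiff_const

theorem gradient_gradient_comm {η : Space d → ℝ} (h : ContDiff ℝ ∞ η) (x : Space d)
    (j k : Fin d) :
    gradient (fun y => gradient η y j) x k = gradient (fun y => gradient η y k) x j := by
  have hd : DifferentiableAt ℝ (fderiv ℝ η) x :=
    (h.fderiv_right (m := ∞) (by simp)).differentiable (by simp) x
  have hs : IsSymmSndFDerivAt ℝ η x := h.contDiffAt.isSymmSndFDerivAt (by
    rw [minSmoothness_of_isRCLikeNormedField]
    exact WithTop.coe_le_coe.2 le_top)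
  have hj (i : Fin d) (v : Space d) :
      fderiv ℝ (fun y => fderiv ℝ η y (unitVec i)) x v = fderiv ℝ (fderiv ℝ η) x v (unitVec i) := by
    rw [fderiv_clm_apply hd (differentiableAt_const _)]
    simp
  simp_rw [gradient_apply]
  rw [hj, hj, hs.eq]

theorem integral_gradient_eq_zero {U : Set (Space d)} {η : Space d → ℝ} (h : IsTest U η)
    (j : Fin d) : ∫ x, gradient η x j = 0 := by
  obtain ⟨C, hC⟩ := ContDiff.lipschitzWith_of_hasCompactSupport h.compact h.smooth (by simp)
  have := LipschitzWith.integral_lineDeriv_mul_eq (μ := volume)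
    (LipschitzWith.const (1 : ℝ) : LipschitzWith 0 fun _ : Space d => (1 : ℝ)) hC h.compact
    (-unitVec j)
  have h0 (x : Space d) : lineDeriv ℝ (fun _ : Space d => (1 : ℝ)) x (-unitVec j) = 0 := by
    simp [lineDeriv]
  simp only [h0, zero_mul, integral_zero, neg_neg, mul_one] at this
  rw [this]
  refine integral_congr_ae (Eventually.of_forall fun x => ?_)
  exact (gradient_apply j).trans
    ((h.smooth.differentiable (by simp)) x).lineDeriv_eq_fderiv.symm

theorem IsTest.integrable_mul {U : Set (Space d)} {η g : Space d → ℝ} (h : IsTest U η)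
    (hg : LocallyIntegrable g) : Integrable fun x => η x * g x :=
  hg.integrable_smul_left_of_hasCompactSupport h.smooth.continuous h.compact

theorem IsTest.integrable {U : Set (Space d)} {η : Space d → ℝ} (h : IsTest U η) :
    Integrable η :=
  h.smooth.continuous.integrable_of_hasCompactSupport h.compact

theorem locallyIntegrable_apply {G : Space d → Space d} (hG : LocallyIntegrable G) (k : Fin d) :
    LocallyIntegrable fun x => G x k := by
  rw [locallyIntegrable_iff] at hG ⊢
  exact fun K hK => (EuclideanSpace.proj k : Space d →L[ℝ] ℝ).integrable_comp (hG K hK)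

theorem inner_eq_sum_mul (x y : Space d) : inner ℝ x y = ∑ j, x j * y j := by
  simp [PiLp.inner_apply, mul_comm]

theorem IsTest.integrable_inner {U : Set (Space d)} {η : Space d → ℝ} (h : IsTest U η)
    {G : Space d → Space d} (hG : LocallyIntegrable G) :
    Integrable fun x => inner ℝ (gradient η x) (G x) := by
  simp_rw [inner_eq_sum_mul]
  exact integrable_finsetSum _ fun j _ =>
    (h.partial j).integrable_mul (locallyIntegrable_apply hG j)

theorem IsTest.setIntegral_eq {U : Set (Space d)} {η g : Space d → ℝ} (h : IsTest U η)
    (hg : ∀ x, gradient η x = 0 → g x = 0) : ∫ x in U, g x = ∫ x, g x :=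
  setIntegral_eq_integral_of_forall_compl_eq_zero fun _ hx =>
    hg _ (gradient_eq_zero_of_notMem fun hx' => hx (h.support hx'))

/-- Weak gradients are unique, so that they inherit skew-symmetry. -/
theorem IsH1Loc.grad_eq_neg {u v : Space d → ℝ} {G H : Space d → Space d} (hu : IsH1Loc u G)
    (hv : IsH1Loc v H) (huv : ∀ᵐ x, u x = - v x) : ∀ᵐ x, G x = - H x := by
  have hG := locallyIntegrable_of_memLp hu.memLp_grad
  have hH := locallyIntegrable_of_memLp hv.memLp_grad
  have hk (k : Fin d) : ∀ᵐ x, G x k + H x k = 0 := by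
    refine ae_eq_zero_of_integral_contDiff_smul_eq_zero
      ((locallyIntegrable_apply hG k).add (locallyIntegrable_apply hH k)) fun η hη hηc => ?_
    have ht : IsTest Set.univ η := ⟨hη, hηc, Set.subset_univ _⟩
    have h1 := hu.weak_grad η ht k
    have h2 := hv.weak_grad η ht k
    have h3 : ∫ x, u x * gradient η x k = - ∫ x, v x * gradient η x k := by
      rw [← integral_neg]
      refine integral_congr_ae ?_
      filter_upwards [huv] with x hx
      rw [hx, neg_mul]
    simp only [smul_eq_mul, mul_add]
    rw [integral_add (ht.integrable_mul (locallyIntegrable_apply hG k))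
      (ht.integrable_mul (locallyIntegrable_apply hH k))]
    simp only [mul_comm (η _)]
    linarith
  filter_upwards [ae_all_iff.2 hk] with x hx
  ext k
  have := hx k
  rw [PiLp.neg_apply]
  linarith

section Corrector

variable {lam : ℝ} {a : Space d → Space d →L[ℝ] Space d} {ah : Space d →L[ℝ] Space d}
  {φ : Fin d → Space d → ℝ} {Gφ : Fin d → Space d → Space d}
  {σ : Fin d → Fin d → Fin d → Space d → ℝ} {Gσ : Fin d → Fin d → Fin d → Space d → Space d}

theorem IsCoeff.memLp_flux (ha : IsCoeff lam a) (hlam : 0 < lam) {μ : Measure (Space d)}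
    [IsFiniteMeasure μ] {G : Fin d → Space d → Space d} {i : Fin d} (hG : MemLp (G i) 2 μ) :
    MemLp (flux a G i) 2 μ :=
  ha.memLp hlam (W := fun x => unitVec i + G i x) ((memLp_const (unitVec i)).add hG)

theorem IsCorrector.locallyIntegrable_grad_sigma (h : IsCorrector a ah φ Gφ σ Gσ)
    (i j k : Fin d) : LocallyIntegrable (Gσ i j k) :=
  locallyIntegrable_of_memLp (h.h1_sigma i j k).memLp_grad

/-- `∇ · ∇ · σ_i = 0`, since `σ_i` is skew-symmetric and second derivatives commute. -/
theorem IsCorrector.sum_integral_eq_zero (h : IsCorrector a ah φ Gφ σ Gσ) (i : Fin d)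
    {U : Set (Space d)} {η : Space d → ℝ} (hη : IsTest U η) :
    ∑ j, ∑ k, ∫ x, gradient η x j * Gσ i j k x k = 0 := by
  have h1 (j k : Fin d) : ∫ x, gradient η x j * Gσ i j k x k
      = - ∫ x, σ i j k x * gradient (fun y => gradient η y j) x k := by
    rw [(h.h1_sigma i j k).weak_grad _ ((hη.partial j).mono (Set.subset_univ _)) k, neg_neg]
    simp only [mul_comm]
  have h2 (j k : Fin d) : ∫ x, gradient η x j * Gσ i j k x k
      = - ∫ x, gradient η x k * Gσ i k j x j := by
    rw [h1, h1, ← integral_neg, ← integral_neg, ← integral_neg]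
    refine integral_congr_ae ?_
    filter_upwards [h.skew i j k] with x hx
    rw [hx, gradient_gradient_comm hη.smooth]
    ring
  have h3 : ∑ j, ∑ k, ∫ x, gradient η x j * Gσ i j k x k
      = - ∑ j, ∑ k, ∫ x, gradient η x j * Gσ i j k x k := by
    conv_lhs => rw [Finset.sum_comm]
    simp_rw [← Finset.sum_neg_distrib]
    exact Finset.sum_congr rfl fun k _ => Finset.sum_congr rfl fun j _ => h2 j k
  linarith

theorem IsCorrector.integral_inner_flux_eq_zero (h : IsCorrector a ah φ Gφ σ Gσ) (i : Fin d)
    {U : Set (Space d)} {η : Space d → ℝ} (hη : IsTest U η) :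
    ∫ x, inner ℝ (gradient η x) (flux a Gφ i x) = 0 := by
  have h1 : ∀ᵐ x, inner ℝ (gradient η x) (flux a Gφ i x)
      = ∑ j, (gradient η x j * ah (unitVec i) j + ∑ k, gradient η x j * Gσ i j k x k) := by
    filter_upwards [ae_all_iff.2 (h.flux_eq i)] with x hx
    rw [inner_eq_sum_mul]
    refine Finset.sum_congr rfl fun j _ => ?_
    rw [hx j, mul_add, Finset.mul_sum]
  have hint (j k : Fin d) : Integrable fun x => gradient η x j * Gσ i j k x k :=
    (hη.partial j).integrable_mul
      (locallyIntegrable_apply (h.locallyIntegrable_grad_sigma i j k) k)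
  have hint' (j : Fin d) : Integrable fun x => gradient η x j * ah (unitVec i) j :=
    (hη.partial j).integrable.mul_const _
  have hsum (j : Fin d) : Integrable fun x => ∑ k, gradient η x j * Gσ i j k x k :=
    integrable_finsetSum _ fun k _ => hint j k
  have hadd (j : Fin d) : Integrable fun x =>
      gradient η x j * ah (unitVec i) j + ∑ k, gradient η x j * Gσ i j k x k :=
    (hint' j).add (hsum j)
  rw [integral_congr_ae h1, integral_finsetSum _ fun j _ => hadd j]
  simp_rw [fun j => integral_add (hint' j) (hsum j),
    fun j => integral_finsetSum Finset.univ fun k _ => hint j k, integral_mul_const,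
    integral_gradient_eq_zero hη, zero_mul, zero_add]
  exact h.sum_integral_eq_zero i hη

end Corrector

/-- In two dimensions `σ_i` has a single component, and `q_i = a_h e_i + ∇ · σ_i` is its rotated
gradient up to a constant. Hence the gauge equation holds automatically. -/
theorem IsCorrector.solvesGauge_two {a : Space 2 → Space 2 →L[ℝ] Space 2}
    {ah : Space 2 →L[ℝ] Space 2} {φ : Fin 2 → Space 2 → ℝ} {Gφ : Fin 2 → Space 2 → Space 2}
    {σ : Fin 2 → Fin 2 → Fin 2 → Space 2 → ℝ}
    {Gσ : Fin 2 → Fin 2 → Fin 2 → Space 2 → Space 2} (h : IsCorrector a ah φ Gφ σ Gσ) :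
    SolvesGauge Set.univ (flux a Gφ) Gσ := by
  intro i j k η hη
  simp only [Measure.restrict_univ]
  have hskew (j k : Fin 2) : ∀ᵐ x, Gσ i j k x = - Gσ i k j x :=
    (h.h1_sigma i j k).grad_eq_neg (h.h1_sigma i k j) (h.skew i j k)
  have hae : ∀ᵐ x, flux a Gφ i x k * gradient η x j - flux a Gφ i x j * gradient η x k
      = gradient η x j * ah (unitVec i) k - gradient η x k * ah (unitVec i) j
        - inner ℝ (gradient η x) (Gσ i j k x) := by
    filter_upwards [ae_all_iff.2 (h.flux_eq i),
      ae_all_iff.2 fun j => ae_all_iff.2 fun k => hskew j k] with x hx hs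
    have hzero {v : Space 2} (hv : v = -v) : v = 0 := by
      ext m
      have hm : v m = - v m := congrArg (fun z : Space 2 => z m) hv
      rw [PiLp.zero_apply]
      linarith
    have h00 : Gσ i 0 0 x = 0 := hzero (hs 0 0)
    have h11 : Gσ i 1 1 x = 0 := hzero (hs 1 1)
    have h10 : Gσ i 1 0 x = - Gσ i 0 1 x := hs 1 0
    rw [hx j, hx k, inner_eq_sum_mul]
    simp only [Fin.sum_univ_two]
    fin_cases j <;> fin_cases k <;> simp [h00, h11, h10] <;> ring
  have hi1 : Integrable fun x => gradient η x j * ah (unitVec i) k :=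
    (hη.partial j).integrable.mul_const _
  have hi2 : Integrable fun x => gradient η x k * ah (unitVec i) j :=
    (hη.partial k).integrable.mul_const _
  have hi3 : Integrable fun x =>
      gradient η x j * ah (unitVec i) k - gradient η x k * ah (unitVec i) j := hi1.sub hi2
  rw [integral_congr_ae hae, integral_sub hi3
    (hη.integrable_inner (h.locallyIntegrable_grad_sigma i j k)), integral_sub hi1 hi2,
    integral_mul_const, integral_mul_const, integral_gradient_eq_zero hη,
    integral_gradient_eq_zero hη]
  ring

section Difference

variable {lam : ℝ} {a : Space d → Space d →L[ℝ] Space d} {ah : Space d →L[ℝ] Space d}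
  {φ : Fin d → Space d → ℝ} {Gφ : Fin d → Space d → Space d}
  {σ : Fin d → Fin d → Fin d → Space d → ℝ} {Gσ : Fin d → Fin d → Fin d → Space d → Space d}
  {L : ℝ} {φL : Fin d → Space d → ℝ} {GφL : Fin d → Space d → Space d}
  {σL : Fin d → Fin d → Fin d → Space d → ℝ} {GσL : Fin d → Fin d → Fin d → Space d → Space d}

theorem IsCorrector.solvesGauge (h : IsCorrector a ah φ Gφ σ Gσ) (hd : 2 ≤ d)
    (hg : 3 ≤ d → SolvesGauge Set.univ (flux a Gφ) Gσ) :
    SolvesGauge Set.univ (flux a Gφ) Gσ := by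
  rcases hd.eq_or_lt with rfl | h3
  · exact h.solvesGauge_two
  · exact hg h3

theorem SolvesGauge.mono {U : Set (Space d)} {q : Fin d → Space d → Space d}
    (h : SolvesGauge Set.univ q Gσ) : SolvesGauge U q Gσ := by
  intro i j k η hη
  have := h i j k η (hη.mono (Set.subset_univ _))
  rw [Measure.restrict_univ] at this
  rw [hη.setIntegral_eq fun x hx => by simp [hx], hη.setIntegral_eq fun x hx => by simp [hx], this]

theorem flux_sub (i : Fin d) (x : Space d) :
    flux a GφL i x - flux a Gφ i x = a x (GφL i x - Gφ i x) := by
  rw [flux, flux, ← map_sub, add_sub_add_left_eq_sub]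

theorem weak_eq_phi_sub (hlam : 0 < lam) (ha : IsCoeff lam a) (h : IsCorrector a ah φ Gφ σ Gσ)
    (hL : IsProxy a L φL GφL σL GσL) (i : Fin d) {η : Space d → ℝ}
    (hη : IsTest (cube d (2 * L)) η) :
    ∫ x in cube d (2 * L), inner ℝ (gradient η x) (a x (GφL i x - Gφ i x)) = 0 := by
  have hgr := memLp_cube_of_continuous (continuous_gradient hη.smooth) (2 * L)
  have h1 := integrable_inner_of_memLp hgr (ha.memLp_flux hlam (hL.h10_phi i).memLp_grad)
  have h2 := integrable_inner_of_memLp hgr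
    (ha.memLp_flux hlam ((h.h1_phi i).memLp_grad_cube (2 * L)))
  simp_rw [← flux_sub, inner_sub_right]
  rw [integral_sub h1 h2, hL.eq_phi i η hη, hη.setIntegral_eq fun x hx => by simp [hx],
    h.integral_inner_flux_eq_zero i hη, sub_zero]

/-- The right-hand side `p_j e_k - p_k e_j`, where `p` is the difference of the fluxes, of the
equation for the difference of the flux correctors. -/
noncomputable def gaugeField (a : Space d → Space d →L[ℝ] Space d)
    (W : Space d → Space d) (j k : Fin d) (x : Space d) : Space d :=
  a x (W x) j • unitVec k - a x (W x) k • unitVec j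

theorem norm_unitVec (i : Fin d) : ‖(unitVec i : Space d)‖ = 1 := by simp [unitVec]

theorem inner_unitVec (x : Space d) (i : Fin d) : inner ℝ x (unitVec i) = x i := by
  simp [unitVec, EuclideanSpace.inner_single_right]

theorem IsCoeff.norm_gaugeField_le (ha : IsCoeff lam a) (hlam : 0 < lam) (W : Space d → Space d)
    (j k : Fin d) (x : Space d) : ‖gaugeField a W j k x‖ ≤ 2 * ‖W x‖ := by
  refine (norm_sub_le _ _).trans ?_
  rw [norm_smul, norm_smul, norm_unitVec, norm_unitVec, Real.norm_eq_abs, Real.norm_eq_abs]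
  linarith [abs_apply_le_norm (a x (W x)) j, abs_apply_le_norm (a x (W x)) k,
    ha.norm_le hlam x (W x)]

theorem IsCoeff.memLp_gaugeField (ha : IsCoeff lam a) (hlam : 0 < lam) {μ : Measure (Space d)}
    {W : Space d → Space d} (hW : MemLp W 2 μ) (j k : Fin d) :
    MemLp (gaugeField a W j k) 2 μ := by
  have hm (i : Fin d) : AEStronglyMeasurable (fun x => a x (W x) i) μ :=
    (EuclideanSpace.proj i : Space d →L[ℝ] ℝ).continuous.comp_aestronglyMeasurable
      (ha.aestronglyMeasurable hW.1)
  exact hW.of_le_mul (((hm j).smul aestronglyMeasurable_const).sub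
    ((hm k).smul aestronglyMeasurable_const))
    (Eventually.of_forall (ha.norm_gaugeField_le hlam W j k))

theorem weak_eq_sigma_sub (hlam : 0 < lam) (ha : IsCoeff lam a)
    (h : IsCorrector a ah φ Gφ σ Gσ) (hL : IsProxy a L φL GφL σL GσL)
    (hg : SolvesGauge Set.univ (flux a Gφ) Gσ) (i j k : Fin d) {η : Space d → ℝ}
    (hη : IsTest (cube d (2 * L)) η) :
    ∫ x in cube d (2 * L), inner ℝ (gradient η x) (GσL i j k x - Gσ i j k x)
      = ∫ x in cube d (2 * L), inner ℝ (gradient η x)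
          (gaugeField a (fun x => GφL i x - Gφ i x) j k x) := by
  set μ := volume.restrict (cube d (2 * L)) with hμ
  have hgr : MemLp (gradient η) 2 μ :=
    memLp_cube_of_continuous (continuous_gradient hη.smooth) (2 * L)
  have hq : MemLp (flux a Gφ i) 2 μ :=
    ha.memLp_flux hlam ((h.h1_phi i).memLp_grad_cube (2 * L))
  have hqL : MemLp (flux a GφL i) 2 μ := ha.memLp_flux hlam (hL.h10_phi i).memLp_grad
  have hp (m n : Fin d) {q : Space d → Space d} (hq : MemLp q 2 μ) :
      Integrable (fun x => q x m * gradient η x n) μ := by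
    have h1 : MemLp (fun x => q x m) 2 μ := (EuclideanSpace.proj m : Space d →L[ℝ] ℝ).comp_memLp' hq
    have h2 : MemLp (fun x => gradient η x n) 2 μ :=
      (EuclideanSpace.proj n : Space d →L[ℝ] ℝ).comp_memLp' hgr
    exact h1.integrable_mul h2
  have hpp {q : Space d → Space d} (hq : MemLp q 2 μ) :
      Integrable (fun x => -(q x k * gradient η x j - q x j * gradient η x k)) μ :=
    ((hp k j hq).sub (hp j k hq)).neg
  have e1 := hL.eq_sigma i j k η hη
  have e2 := hg.mono i j k η hη
  simp_rw [inner_sub_right]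
  rw [integral_sub (integrable_inner_of_memLp hgr (hL.h10_sigma i j k).memLp_grad)
    (integrable_inner_of_memLp hgr ((h.h1_sigma i j k).memLp_grad_cube (2 * L))), e1, e2,
    ← integral_neg, ← integral_neg, ← integral_sub (hpp hqL) (hpp hq)]
  refine integral_congr_ae (Eventually.of_forall fun x => ?_)
  simp only [gaugeField, ← flux_sub, inner_sub_right, inner_smul_right, inner_unitVec,
    PiLp.sub_apply]
  ring

end Difference

/-! ### Integration by parts against a mask -/

theorem tsupport_subset_cube {r s : ℝ} (hrs : r < s) {g : Space d → ℝ}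
    (hg : Function.support g ⊆ cube d r) : tsupport g ⊆ cube d s :=
  (closure_minimal (hg.trans (cube_subset_closedCube r)) (isCompact_closedCube r).isClosed).trans
    (closedCube_subset_cube hrs)

theorem lineDeriv_eq_zero_of_notMem_tsupport {g : Space d → ℝ} {x : Space d}
    (hx : x ∉ tsupport g) (v : Space d) : lineDeriv ℝ g x v = 0 := by
  rw [(notMem_tsupport_iff_eventuallyEq.1 hx).lineDeriv_eq]
  simp [lineDeriv]

/-- The mask is only Lipschitz, so that its derivative is taken as a line derivative, which exists
almost everywhere. -/
theorem integral_mul_gradient_eq_of_contDiff {r R : ℝ} (hrR : r < R) {C : ℝ≥0} {g v : Space d → ℝ}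
    (hg : LipschitzWith C g) (hgs : Function.support g ⊆ cube d r) (hv : ContDiff ℝ ∞ v)
    (k : Fin d) :
    ∫ x in cube d R, gradient v x k * g x
      = ∫ x in cube d R, lineDeriv ℝ g x (-unitVec k) * v x := by
  obtain ⟨r', hr', hr'R⟩ := exists_between hrR
  obtain ⟨K, -, χ, hχ⟩ := exists_cutoff_unit (d := d) hr'R
  have hts := tsupport_subset_cube hr' hgs
  have hone : ∀ x ∈ cube d r', χ x = 1 := by simpa using hχ.eq_one
  have hf : ContDiff ℝ ∞ fun x => χ x * v x := hχ.test.smooth.mul hv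
  obtain ⟨D, hD⟩ := ContDiff.lipschitzWith_of_hasCompactSupport (𝕂 := ℝ)
    (hχ.test.compact.mul_right (f' := v)) hf (by simp)
  have hgc : HasCompactSupport g := (isCompact_closedCube r).of_isClosed_subset
    (isClosed_tsupport _) (closure_minimal (hgs.trans (cube_subset_closedCube r))
      (isCompact_closedCube r).isClosed)
  have key := LipschitzWith.integral_lineDeriv_mul_eq (μ := volume) hD hg hgc (unitVec k)
  have h1 : ∀ x, lineDeriv ℝ (χ * v) x (unitVec k) * g x = gradient v x k * g x := by
    intro x
    by_cases hx : x ∈ cube d r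
    · have hnhds : χ * v =ᶠ[𝓝 x] v := by
        filter_upwards [(isOpen_cube r).mem_nhds hx] with y hy
        simp [hone y (cube_subset hr'.le hy)]
      rw [hnhds.lineDeriv_eq, (hv.differentiable (by simp) x).lineDeriv_eq_fderiv, gradient_apply]
    · have : g x = 0 := by
        by_contra h
        exact hx (hgs h)
      simp [this]
  have h2 : ∀ x, lineDeriv ℝ g x (-unitVec k) * (χ x * v x)
      = lineDeriv ℝ g x (-unitVec k) * v x := by
    intro x
    by_cases hx : x ∈ tsupport g
    · rw [hone x (hts hx), one_mul]
    · simp [lineDeriv_eq_zero_of_notMem_tsupport hx]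
  have hout {x : Space d} (hx : x ∉ cube d R) : x ∉ tsupport g :=
    fun h => hx (cube_subset hr'R.le (hts h))
  rw [setIntegral_eq_integral_of_forall_compl_eq_zero,
    setIntegral_eq_integral_of_forall_compl_eq_zero]
  · rw [← integral_congr_ae (Eventually.of_forall h1), ← integral_congr_ae (Eventually.of_forall h2)]
    exact key
  · intro x hx
    simp [lineDeriv_eq_zero_of_notMem_tsupport (hout hx)]
  · intro x hx
    simp [image_eq_zero_of_notMem_tsupport (hout hx)]

theorem abs_integral_mul_grad_le {r R : ℝ} (hrR : r < R) {C : ℝ≥0} {g u : Space d → ℝ}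
    {G : Space d → Space d} (hg : LipschitzWith C g) (hgs : Function.support g ⊆ cube d r)
    (hu : IsH1On (cube d R) u G) (k : Fin d) :
    |∫ x in cube d R, g x * G x k| ≤ C * ∫ x in cube d R, |u x| := by
  set μ := volume.restrict (cube d R) with hμ
  have hDle (x : Space d) : ‖lineDeriv ℝ g x (-unitVec k)‖ ≤ C := by
    simpa [norm_unitVec] using norm_lineDeriv_le_of_lipschitz ℝ hg (x₀ := x) (v := -unitVec k)
  have hDm : MemLp (fun x => lineDeriv ℝ g x (-unitVec k)) 2 μ :=
    MemLp.of_bound (measurable_lineDeriv hg.continuous).aestronglyMeasurable C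
      (Eventually.of_forall hDle)
  have hgm : MemLp (fun x => g x • (unitVec k : Space d)) 2 μ :=
    memLp_cube_of_continuous (hg.continuous.smul continuous_const) R
  obtain ⟨v, hv, hv1, hv2⟩ := hu.approx
  have hvm (n) : MemLp (v n) 2 μ := memLp_cube_of_continuous (hv n).continuous R
  have hvg (n) : MemLp (gradient (v n)) 2 μ :=
    memLp_cube_of_continuous (continuous_gradient (hv n)) R
  have hlim1 := tendsto_integral_inner hvg hu.memLp_grad hgm hv2
  have hlim2 := tendsto_integral_inner hvm hu.memLp hDm hv1
  simp only [inner_smul_right, inner_unitVec, RCLike.inner_apply, conj_trivial] at hlim1 hlim2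
  have heq : ∫ x, g x * G x k ∂μ = ∫ x, lineDeriv ℝ g x (-unitVec k) * u x ∂μ := by
    refine tendsto_nhds_unique hlim1 (hlim2.congr fun n => ?_)
    have := integral_mul_gradient_eq_of_contDiff hrR hg hgs (hv n) k
    simp only [mul_comm _ (g _)] at this
    exact this.symm
  rw [heq, ← integral_const_mul, ← Real.norm_eq_abs]
  refine norm_integral_le_of_norm_le (μ := μ) ((hu.memLp.integrable (by norm_num)).abs.const_mul _)
    (Eventually.of_forall fun x => ?_)
  rw [norm_mul, Real.norm_eq_abs (u x)]
  exact mul_le_mul_of_nonneg_right (hDle x) (abs_nonneg _)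

theorem IsMask.abs_le {M : ℝ≥0} {mask : Space d → ℝ} (h : IsMask M mask) (i : Fin d)
    (x : Space d) : |mask x| ≤ 2 * M := by
  by_cases hx : x ∈ cube d 1
  · -- a translate by two units leaves the support
    have hy : mask (x + (2 : ℝ) • unitVec i) = 0 := by
      by_contra hne
      have h1 := h.support hne i
      have h2 := hx i
      simp only [unitVec, PiLp.add_apply, PiLp.smul_apply, PiLp.single_apply, smul_eq_mul,
        if_true, mul_one] at h1
      rw [abs_lt] at h1 h2
      linarith
    have := h.lipschitz.dist_le_mul x (x + (2 : ℝ) • unitVec i)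
    rw [hy, Real.dist_eq, sub_zero, dist_self_add_right, norm_smul, norm_unitVec] at this
    simp only [Real.norm_ofNat, mul_one] at this
    linarith
  · have : mask x = 0 := by
      by_contra hne
      exact hx (h.support hne)
    simp [this]

/-- The mask `L^{-d} mask(x / L)` at scale `L`. -/
noncomputable def scaledMask (L : ℝ) (mask : Space d → ℝ) (x : Space d) : ℝ :=
  (L ^ d)⁻¹ * mask (L⁻¹ • x)

section Mask

variable {M : ℝ≥0} {mask : Space d → ℝ} {L : ℝ}

theorem IsMask.lipschitz_scaled (h : IsMask M mask) (hL : 0 < L) :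
    LipschitzWith (Real.toNNReal ((L ^ d)⁻¹ * (M * L⁻¹))) (scaledMask L mask) := by
  refine LipschitzWith.of_dist_le' fun x y => ?_
  have := h.lipschitz.dist_le_mul (L⁻¹ • x) (L⁻¹ • y)
  rw [dist_smul₀, Real.norm_of_nonneg (inv_nonneg.2 hL.le), Real.dist_eq] at this
  rw [scaledMask, scaledMask, Real.dist_eq, ← mul_sub, abs_mul, abs_of_pos (by positivity),
    mul_assoc, mul_assoc]
  gcongr

theorem IsMask.support_scaled (h : IsMask M mask) (hL : 0 < L) :
    Function.support (scaledMask L mask) ⊆ cube d L := by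
  intro x hx
  have : L⁻¹ • x ∈ cube d 1 := h.support (right_ne_zero_of_mul hx)
  rwa [smul_mem_cube hL, mul_one] at this

theorem IsMask.scaled_eq_zero (h : IsMask M mask) (hL : 0 < L) {x : Space d} (hx : x ∉ cube d L) :
    scaledMask L mask x = 0 := by
  by_contra hne
  exact hx (h.support_scaled hL hne)

theorem IsMask.abs_scaled_le (h : IsMask M mask) (hL : 0 < L) (i : Fin d) (x : Space d) :
    |scaledMask L mask x| ≤ (L ^ d)⁻¹ * (2 * M) := by
  rw [scaledMask, abs_mul, abs_of_pos (by positivity)]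
  gcongr
  exact h.abs_le i _

theorem IsMask.integral_scaled (h : IsMask M mask) (hL : 0 < L) :
    ∫ x, scaledMask L mask x = 1 := by
  simp only [scaledMask]
  rw [integral_const_mul, Measure.integral_comp_inv_smul, h.integral_eq]
  simp [abs_of_pos hL, hL.ne']

end Mask

/-! ### Averages -/

/-- Jensen's inequality on a set of measure at most `V`. -/
theorem integral_le_of_integral_sq_le {S : Set (Space d)} {g : Space d → ℝ} {T V : ℝ}
    [IsFiniteMeasure (volume.restrict S)] (hT : 0 < T) (hg : MemLp g 2 (volume.restrict S))
    (hS : volume.real S ≤ V)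
    (h : ∫ x in S, g x ^ 2 ≤ T ^ 2 * V) : ∫ x in S, |g x| ≤ T * V := by
  have hpt (x : Space d) : |g x| ≤ T / 2 + (2 * T)⁻¹ * g x ^ 2 := by
    have : 0 ≤ (2 * T)⁻¹ * (|g x| - T) ^ 2 := by positivity
    have he : (2 * T)⁻¹ * (|g x| - T) ^ 2 = T / 2 + (2 * T)⁻¹ * |g x| ^ 2 - |g x| := by
      field_simp
      ring
    rw [sq_abs] at he
    linarith
  have h1 := integral_mono (hg.integrable (by norm_num)).abs
    ((integrable_const (T / 2)).add (hg.integrable_sq.const_mul (2 * T)⁻¹)) hpt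
  simp only [Pi.add_apply] at h1
  rw [integral_add (integrable_const _) (hg.integrable_sq.const_mul _), integral_const_mul,
    setIntegral_const, smul_eq_mul] at h1
  calc _ ≤ _ := h1
    _ ≤ V * (T / 2) + (2 * T)⁻¹ * (T ^ 2 * V) := by gcongr
    _ = T * V := by
      field_simp
      ring

theorem rms_le {ι E : Type} [Fintype ι] [NormedAddCommGroup E] {r A B : ℝ} (hr : 0 < r)
    {F : ι → Space d → E} (hF : ∀ n, MemLp (F n) 2 (volume.restrict (cube d r)))
    (hB : 0 ≤ B)
    (h : ∀ n, ∫ x in cube d r, ‖F n x‖ ^ 2 ≤ A * volume.real (cube d r))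
    (hAB : Fintype.card ι * A ≤ B ^ 2) :
    rms (cube d r) F ≤ B := by
  have hV := volume_real_cube_pos (d := d) hr
  rw [rms, Real.sqrt_le_left hB, setAverage_eq, smul_eq_mul, inv_mul_le_iff₀ hV,
    integral_finsetSum _ fun n _ => (memLp_two_iff_integrable_sq_norm (hF n).1).1 (hF n)]
  calc _ ≤ ∑ _n : ι, A * volume.real (cube d r) := Finset.sum_le_sum fun n _ => h n
    _ = volume.real (cube d r) * (Fintype.card ι * A) := by
      rw [Finset.sum_const, Finset.card_univ, nsmul_eq_mul]
      ring
    _ ≤ _ := by gcongr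

theorem integral_sq_le_of_rms_le {ι : Type} [Fintype ι] {r B : ℝ} (hr : 0 < r)
    {F : ι → Space d → ℝ} (hF : ∀ n, MemLp (F n) 2 (volume.restrict (cube d r)))
    (h : 1 / r * rms (cube d r) F ≤ B) (n : ι) :
    ∫ x in cube d r, F n x ^ 2 ≤ (r * B) ^ 2 * volume.real (cube d r) := by
  have hV := volume_real_cube_pos (d := d) hr
  have h1 : rms (cube d r) F ≤ r * B := by
    rwa [one_div, inv_mul_le_iff₀ hr] at h
  have hint (m : ι) : Integrable (fun x => ‖F m x‖ ^ 2) (volume.restrict (cube d r)) :=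
    (memLp_two_iff_integrable_sq_norm (hF m).1).1 (hF m)
  have h0 : 0 ≤ r * B := (Real.sqrt_nonneg _).trans h1
  rw [rms, Real.sqrt_le_left h0, setAverage_eq, smul_eq_mul, inv_mul_le_iff₀ hV] at h1
  rw [mul_comm]
  refine le_trans (integral_mono (hF n).integrable_sq
    (integrable_finsetSum _ fun m _ => hint m) fun x => ?_) h1
  rw [← sq_abs, ← Real.norm_eq_abs]
  exact Finset.single_le_sum (f := fun m => ‖F m x‖ ^ 2) (fun m _ => by positivity)
    (Finset.mem_univ n)

theorem volume_cube_two_mul_le {r L : ℝ} (hr : 1 ≤ r) (hL : 0 < L) :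
    volume.real (cube d (2 * L)) ≤ 2 ^ d * volume.real (cube d (r * L)) := by
  rw [volume_real_cube (by positivity : 0 < 2 * L), volume_real_cube (by positivity : 0 < r * L),
    mul_pow, mul_pow]
  have h1 : 1 ≤ r ^ d := one_le_pow₀ hr
  calc (2 : ℝ) ^ d * L ^ d * volume.real (cube d 1)
      = 2 ^ d * (1 * L ^ d * volume.real (cube d 1)) := by ring
    _ ≤ _ := by gcongr

theorem integral_sub_sq_le {S : Set (Space d)} {f g : Space d → ℝ} {B : ℝ}
    (hf : MemLp f 2 (volume.restrict S)) (hg : MemLp g 2 (volume.restrict S))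
    (h1 : ∫ x in S, f x ^ 2 ≤ B) (h2 : ∫ x in S, g x ^ 2 ≤ B) :
    ∫ x in S, (f x - g x) ^ 2 ≤ 4 * B := by
  have h := integral_mono (hf.sub hg).integrable_sq
    ((hf.integrable_sq.const_mul 2).add (hg.integrable_sq.const_mul 2)) fun x => by
      simp only [Pi.sub_apply, Pi.add_apply]
      show _ ≤ 2 * f x ^ 2 + 2 * g x ^ 2
      linarith [sq_nonneg (f x + g x)]
  simp only [Pi.add_apply, Pi.sub_apply] at h
  rw [integral_add (hf.integrable_sq.const_mul 2) (hg.integrable_sq.const_mul 2),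
    integral_const_mul, integral_const_mul] at h
  linarith

theorem norm_le_sum_abs (x : Space d) : ‖x‖ ≤ ∑ j, |x j| := by
  conv_lhs => rw [eq_sum_unitVec x]
  refine (norm_sum_le _ _).trans (Finset.sum_le_sum fun j _ => ?_)
  rw [norm_smul, norm_unitVec, mul_one, Real.norm_eq_abs]

theorem opNorm_le_of_unitVec {T : Space d →L[ℝ] Space d} {B : ℝ} (hB : 0 ≤ B)
    (h : ∀ i j, |T (unitVec i) j| ≤ B) : ‖T‖ ≤ d ^ 2 * B := by
  refine T.opNorm_le_bound (by positivity) fun x => ?_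
  conv_lhs => rw [eq_sum_unitVec x]
  rw [map_sum]
  calc ‖∑ i, T (x i • unitVec i)‖ ≤ ∑ i, ‖T (x i • unitVec i)‖ := norm_sum_le _ _
    _ ≤ ∑ _i : Fin d, ‖x‖ * (d * B) := by
      refine Finset.sum_le_sum fun i _ => ?_
      rw [map_smul, norm_smul, Real.norm_eq_abs]
      have h1 : ‖T (unitVec i)‖ ≤ d * B := by
        refine (norm_le_sum_abs _).trans ((Finset.sum_le_sum fun j _ => h i j).trans_eq ?_)
        simp
      gcongr
      exact abs_apply_le_norm x i
    _ = d ^ 2 * B * ‖x‖ := by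
      simp
      ring

/-! ### The error estimates -/

section Estimates

variable {lam : ℝ} {a : Space d → Space d →L[ℝ] Space d} {ah : Space d →L[ℝ] Space d}
  {φ : Fin d → Space d → ℝ} {Gφ : Fin d → Space d → Space d}
  {σ : Fin d → Fin d → Fin d → Space d → ℝ} {Gσ : Fin d → Fin d → Fin d → Space d → Space d}
  {L : ℝ} {φL : Fin d → Space d → ℝ} {GφL : Fin d → Space d → Space d}
  {σL : Fin d → Fin d → Fin d → Space d → ℝ} {GσL : Fin d → Fin d → Fin d → Space d → Space d}

theorem IsCorrector.isH1On_joint (h : IsCorrector a ah φ Gφ σ Gσ) (R : ℝ)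
    (n : Fin d ⊕ (Fin d × Fin d × Fin d)) :
    IsH1On (cube d R) (joint φ σ n) (Sum.elim Gφ (fun p => Gσ p.1 p.2.1 p.2.2) n) :=
  match n with
  | Sum.inl i => (h.h1_phi i).isH1On R
  | Sum.inr p => (h.h1_sigma p.1 p.2.1 p.2.2).isH1On R

theorem IsProxy.isH1On_joint (h : IsProxy a L φL GφL σL GσL)
    (n : Fin d ⊕ (Fin d × Fin d × Fin d)) :
    IsH1On (cube d (2 * L)) (joint φL σL n)
      (Sum.elim GφL (fun p => GσL p.1 p.2.1 p.2.2) n) :=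
  match n with
  | Sum.inl i => (h.h10_phi i).isH1On
  | Sum.inr p => (h.h10_sigma p.1 p.2.1 p.2.2).isH1On

/-- Sublinearity bounds the difference of the proxy and the centred corrector in `L²(Q_{2L})`. -/
theorem integral_joint_sub_sq_le {δ : ℝ} (hL : 0 < L) (h : IsCorrector a ah φ Gφ σ Gσ)
    (hL' : IsProxy a L φL GφL σL GσL)
    (h1 : 1 / (2 * L) * rms (cube d (2 * L)) (centered (cube d (2 * L)) (joint φ σ)) ≤ δ)
    (h2 : 1 / (2 * L) * rms (cube d (2 * L)) (joint φL σL) ≤ δ)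
    (n : Fin d ⊕ (Fin d × Fin d × Fin d)) :
    ∫ x in cube d (2 * L), (joint φL σL n x - centered (cube d (2 * L)) (joint φ σ) n x) ^ 2
      ≤ (4 * L * δ) ^ 2 * volume.real (cube d (2 * L)) := by
  have m1 (n) : MemLp (centered (cube d (2 * L)) (joint φ σ) n) 2
      (volume.restrict (cube d (2 * L))) := ((h.isH1On_joint (2 * L) n).sub_const _).memLp
  have m2 (n) := (hL'.isH1On_joint n).memLp
  have hL2 : 0 < 2 * L := by positivity
  refine (integral_sub_sq_le (m2 n) (m1 n) (integral_sq_le_of_rms_le hL2 m2 h2 n)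
    (integral_sq_le_of_rms_le hL2 m1 h1 n)).trans_eq ?_
  ring

/-- The difference of the correctors is `a`-harmonic in `Q_{2L}`, so that the Caccioppoli inequality
applies without a right-hand side. -/
theorem integral_grad_phi_sub_sq_le {δ K : ℝ} (hlam : 0 < lam) (hL : 0 < L)
    (hcut : ∃ χ : Space d → ℝ, IsCutoff (3 / 2) 2 K L χ)
    (ha : IsCoeff lam a) (h : IsCorrector a ah φ Gφ σ Gσ)
    (hL' : IsProxy a L φL GφL σL GσL)
    (h1 : 1 / (2 * L) * rms (cube d (2 * L)) (centered (cube d (2 * L)) (joint φ σ)) ≤ δ)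
    (h2 : 1 / (2 * L) * rms (cube d (2 * L)) (joint φL σL) ≤ δ) (i : Fin d) :
    ∫ x in cube d (3 / 2 * L), ‖GφL i x - Gφ i x‖ ^ 2
      ≤ 2 / lam * (4 / lam + 1) * (16 * K ^ 2) * δ ^ 2 * volume.real (cube d (2 * L)) := by
  obtain ⟨χ, hχ⟩ := hcut
  have hw := (hL'.isH1On_joint (Sum.inl i)).sub
    ((h.isH1On_joint (2 * L) (Sum.inl i)).sub_const (⨍ y in cube d (2 * L), φ i y))
  have hcac := caccioppoli (f := fun _ => 0) hlam ha hχ (by linarith) le_rfl hw MemLp.zero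
    fun η hη => by simpa using weak_eq_phi_sub hlam ha h hL' i hη
  have hE := integral_joint_sub_sq_le hL h hL' h1 h2 (Sum.inl i)
  simp only [norm_zero, ne_eq, OfNat.ofNat_ne_zero, not_false_eq_true, zero_pow, integral_zero,
    mul_zero, add_zero] at hcac
  have hcac' : lam / 2 * ∫ x in cube d (3 / 2 * L), ‖GφL i x - Gφ i x‖ ^ 2
      ≤ (4 / lam + 1) * (K / L) ^ 2 * ((4 * L * δ) ^ 2 * volume.real (cube d (2 * L))) :=
    hcac.trans (by gcongr; exact hE)
  calc _ = 2 / lam * (lam / 2 * ∫ x in cube d (3 / 2 * L), ‖GφL i x - Gφ i x‖ ^ 2) := by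
        field_simp
    _ ≤ 2 / lam * ((4 / lam + 1) * (K / L) ^ 2
        * ((4 * L * δ) ^ 2 * volume.real (cube d (2 * L)))) := by gcongr
    _ = _ := by
        field_simp
        ring

/-- The Caccioppoli inequality for the Laplacian, with a right-hand side that is controlled by the
gradient of the difference of the correctors. -/
theorem integral_grad_sigma_sub_sq_le {δ K A : ℝ} (hlam : 0 < lam) (hL : 0 < L)
    (hcut : ∃ χ : Space d → ℝ, IsCutoff 1 (3 / 2) K L χ)
    (ha : IsCoeff lam a) (h : IsCorrector a ah φ Gφ σ Gσ)
    (hL' : IsProxy a L φL GφL σL GσL) (hg : SolvesGauge Set.univ (flux a Gφ) Gσ)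
    (h1 : 1 / (2 * L) * rms (cube d (2 * L)) (centered (cube d (2 * L)) (joint φ σ)) ≤ δ)
    (h2 : 1 / (2 * L) * rms (cube d (2 * L)) (joint φL σL) ≤ δ)
    {i : Fin d} (hφ : ∫ x in cube d (3 / 2 * L), ‖GφL i x - Gφ i x‖ ^ 2
      ≤ A * δ ^ 2 * volume.real (cube d (2 * L))) (j k : Fin d) :
    ∫ x in cube d (1 * L), ‖GσL i j k x - Gσ i j k x‖ ^ 2
      ≤ (160 * K ^ 2 + 16 * A) * δ ^ 2 * volume.real (cube d (2 * L)) := by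
  obtain ⟨χ, hχ⟩ := hcut
  have hw := (hL'.isH1On_joint (Sum.inr (i, j, k))).sub
    ((h.isH1On_joint (2 * L) (Sum.inr (i, j, k))).sub_const (⨍ y in cube d (2 * L), σ i j k y))
  have hW : MemLp (fun x => GφL i x - Gφ i x) 2 (volume.restrict (cube d (2 * L))) :=
    (hL'.h10_phi i).memLp_grad.sub ((h.h1_phi i).memLp_grad_cube _)
  have hf := ha.memLp_gaugeField hlam hW j k
  have hcac := caccioppoli one_pos isCoeff_id hχ (by linarith) (by linarith) hw hf
    fun η hη => weak_eq_sigma_sub hlam ha h hL' hg i j k hη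
  have hE := integral_joint_sub_sq_le hL h hL' h1 h2 (Sum.inr (i, j, k))
  have hle : volume.restrict (cube d (3 / 2 * L)) ≤ volume.restrict (cube d (2 * L)) :=
    Measure.restrict_mono (cube_subset (by linarith)) le_rfl
  have hf' : ∫ x in cube d (3 / 2 * L), ‖gaugeField a (fun x => GφL i x - Gφ i x) j k x‖ ^ 2
      ≤ 4 * (A * δ ^ 2 * volume.real (cube d (2 * L))) := by
    have hf2 := hf.mono_measure hle
    have hW2 := hW.mono_measure hle
    have := integral_mono ((memLp_two_iff_integrable_sq_norm hf2.1).1 hf2)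
      (((memLp_two_iff_integrable_sq_norm hW2.1).1 hW2).const_mul 4) fun x => by
        show _ ≤ 4 * ‖GφL i x - Gφ i x‖ ^ 2
        have := pow_le_pow_left₀ (norm_nonneg _)
          (ha.norm_gaugeField_le hlam (fun x => GφL i x - Gφ i x) j k x) 2
        linarith
    rw [integral_const_mul] at this
    linarith
  have hcac' : 1 / 2 * ∫ x in cube d (1 * L), ‖GσL i j k x - Gσ i j k x‖ ^ 2
      ≤ (4 / 1 + 1) * (K / L) ^ 2 * ((4 * L * δ) ^ 2 * volume.real (cube d (2 * L)))
        + (1 / 1 + 1) * (4 * (A * δ ^ 2 * volume.real (cube d (2 * L)))) :=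
    hcac.trans (by gcongr; exact hE)
  have he : (K / L) ^ 2 * ((4 * L * δ) ^ 2 * volume.real (cube d (2 * L)))
      = 16 * K ^ 2 * δ ^ 2 * volume.real (cube d (2 * L)) := by
    field_simp
    ring
  rw [mul_assoc, he] at hcac'
  linarith

/-- Since `q_i = a_h e_i + ∇ · σ_i` and the mask has unit integral, the error of the tensor is the
integral of the mask against `a ∇(φL_i - φ_i) + ∇ · σ_i`. -/
theorem abs_proxyTensor_sub_le {δ A : ℝ} {M : ℝ≥0} {mask : Space d → ℝ} (hlam : 0 < lam)
    (hL : 0 < L) (hδ : 0 < δ) (hA : 0 ≤ A) (ha : IsCoeff lam a) (h : IsCorrector a ah φ Gφ σ Gσ)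
    (hL' : IsProxy a L φL GφL σL GσL) (hM : IsMask M mask)
    (h1 : 1 / (2 * L) * rms (cube d (2 * L)) (centered (cube d (2 * L)) (joint φ σ)) ≤ δ)
    {i : Fin d} (hφ : ∫ x in cube d (3 / 2 * L), ‖GφL i x - Gφ i x‖ ^ 2
      ≤ A * δ ^ 2 * volume.real (cube d (2 * L))) (j : Fin d) :
    |(proxyTensor a L mask GφL - ah) (unitVec i) j|
      ≤ 2 ^ d * volume.real (cube d 1) * (2 * M * Real.sqrt (A + 1) + 2 * d * M) * δ := by
  set V := volume.real (cube d (2 * L)) with hV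
  set μ := volume.restrict (cube d (2 * L)) with hμ
  set m₀ := scaledMask L mask with hm
  have hVpos : 0 < V := volume_real_cube_pos (by positivity)
  have hVeq : (L ^ d)⁻¹ * V = 2 ^ d * volume.real (cube d 1) := by
    rw [hV, volume_real_cube (by positivity), mul_pow]
    field_simp
  have hsub : cube d L ⊆ cube d (2 * L) := cube_subset (by linarith)
  have hmc : Continuous m₀ := (hM.lipschitz_scaled hL).continuous
  have hmm : MemLp m₀ 2 μ := memLp_cube_of_continuous hmc _
  have hmone : ∫ x, m₀ x ∂μ = 1 := by
    rw [← hM.integral_scaled hL]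
    exact setIntegral_eq_integral_of_forall_compl_eq_zero fun x hx =>
      hM.scaled_eq_zero hL fun hx' => hx (hsub hx')
  have hcomp {F : Space d → Space d} (hF : MemLp F 2 μ) (k : Fin d) : MemLp (fun x => F x k) 2 μ :=
    (EuclideanSpace.proj k : Space d →L[ℝ] ℝ).comp_memLp' hF
  have hint {g : Space d → ℝ} (hg : MemLp g 2 μ) : Integrable (fun x => m₀ x * g x) μ :=
    hmm.integrable_mul hg
  have hW : MemLp (fun x => GφL i x - Gφ i x) 2 μ :=
    (hL'.h10_phi i).memLp_grad.sub ((h.h1_phi i).memLp_grad_cube _)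
  have haW := ha.memLp hlam hW
  have hqL : MemLp (flux a GφL i) 2 μ := ha.memLp_flux hlam (hL'.h10_phi i).memLp_grad
  -- the mask tests the flux of the proxy on `Q_{2L}` only
  have hproxy : proxyTensor a L mask GφL (unitVec i) j = ∫ x, m₀ x * flux a GφL i x j ∂μ := by
    rw [proxyTensor_unitVec]
    have e1 : ∫ x, ((L ^ d)⁻¹ * mask (L⁻¹ • x)) • flux a GφL i x
        = ∫ x, m₀ x • flux a GφL i x ∂μ :=
      (setIntegral_eq_integral_of_forall_compl_eq_zero fun x hx => by
        have : scaledMask L mask x = 0 := hM.scaled_eq_zero hL fun hx' => hx (hsub hx')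
        rw [scaledMask] at this
        rw [this, zero_smul]).symm
    have hi : Integrable (fun x => m₀ x • flux a GφL i x) μ :=
      memLp_one_iff_integrable.1 (hqL.smul hmm)
    rw [e1]
    exact ((EuclideanSpace.proj j : Space d →L[ℝ] ℝ).integral_comp_comm hi).symm
  have hGm (k : Fin d) : Integrable (fun x => m₀ x * Gσ i j k x k) μ :=
    hint (hcomp ((h.h1_sigma i j k).memLp_grad_cube _) k)
  have hdecomp : (proxyTensor a L mask GφL - ah) (unitVec i) j
      = ∫ x, m₀ x * a x (GφL i x - Gφ i x) j ∂μ + ∑ k, ∫ x, m₀ x * Gσ i j k x k ∂μ := by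
    have hah : ah (unitVec i) j = ∫ x, m₀ x * ah (unitVec i) j ∂μ := by
      rw [integral_mul_const, hmone, one_mul]
    rw [sub_apply, PiLp.sub_apply, hproxy]
    conv_lhs => rw [hah]
    rw [← integral_sub (hint (hcomp hqL j)) (hint (memLp_const _)),
      ← integral_finsetSum _ fun k _ => hGm k, ← integral_add (hint (hcomp haW j))
        (integrable_finsetSum _ fun k _ => hGm k)]
    refine integral_congr_ae ?_
    filter_upwards [ae_restrict_of_ae (h.flux_eq i j)] with x hx
    rw [← flux_sub, PiLp.sub_apply, hx, ← Finset.mul_sum]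
    ring
  -- the contribution of the difference of the gradients
  have hfirst : |∫ x, m₀ x * a x (GφL i x - Gφ i x) j ∂μ|
      ≤ 2 ^ d * volume.real (cube d 1) * (2 * M * Real.sqrt (A + 1)) * δ := by
    have hle : volume.restrict (cube d (3 / 2 * L)) ≤ μ :=
      Measure.restrict_mono (cube_subset (by linarith)) le_rfl
    have hW' := hW.mono_measure hle
    have hT : 0 < Real.sqrt (A + 1) * δ := by positivity
    have hn : ∫ x in cube d (3 / 2 * L), |‖GφL i x - Gφ i x‖| ≤ Real.sqrt (A + 1) * δ * V := by
      refine integral_le_of_integral_sq_le hT hW'.norm ?_ (hφ.trans ?_)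
      · exact measureReal_mono (cube_subset (by linarith)) (volume_cube_lt_top _).ne
      · rw [mul_pow, Real.sq_sqrt (by positivity)]
        gcongr
        linarith
    simp only [abs_norm] at hn
    have hout : ∫ x, m₀ x * a x (GφL i x - Gφ i x) j ∂μ
        = ∫ x in cube d (3 / 2 * L), m₀ x * a x (GφL i x - Gφ i x) j :=
      setIntegral_eq_of_subset_of_forall_sdiff_eq_zero (measurableSet_cube _)
        (cube_subset (by linarith)) fun x hx => by
          have : m₀ x = 0 := hM.scaled_eq_zero hL fun hx' =>
            hx.2 (cube_subset (by linarith) hx')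
          rw [this, zero_mul]
    rw [hout, ← Real.norm_eq_abs]
    calc _ ≤ ∫ x in cube d (3 / 2 * L), (L ^ d)⁻¹ * (2 * M) * ‖GφL i x - Gφ i x‖ := by
          refine norm_integral_le_of_norm_le ((hW'.norm.integrable (by norm_num)).const_mul _)
            (Eventually.of_forall fun x => ?_)
          rw [norm_mul, Real.norm_eq_abs, Real.norm_eq_abs]
          exact mul_le_mul (hM.abs_scaled_le hL i x)
            ((abs_apply_le_norm _ j).trans (ha.norm_le hlam x _)) (abs_nonneg _) (by positivity)
      _ ≤ (L ^ d)⁻¹ * (2 * M) * (Real.sqrt (A + 1) * δ * V) := by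
          rw [integral_const_mul]
          gcongr
      _ = (L ^ d)⁻¹ * V * (2 * M * Real.sqrt (A + 1)) * δ := by ring
      _ = _ := by rw [hVeq]
  -- the contribution of `∇ · σ`, after an integration by parts
  have hsecond (k : Fin d) : |∫ x, m₀ x * Gσ i j k x k ∂μ|
      ≤ 2 ^ d * volume.real (cube d 1) * (2 * M) * δ := by
    have hu (n) := (h.isH1On_joint (2 * L) n).sub_const (⨍ y in cube d (2 * L), joint φ σ n y)
    have hn : ∫ x in cube d (2 * L), |σ i j k x - ⨍ y in cube d (2 * L), σ i j k y|
        ≤ 2 * L * δ * V :=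
      integral_le_of_integral_sq_le (by positivity) (hu (Sum.inr (i, j, k))).memLp le_rfl
        (integral_sq_le_of_rms_le (by positivity) (fun n => (hu n).memLp) h1 (Sum.inr (i, j, k)))
    have := abs_integral_mul_grad_le (by linarith : L < 2 * L) (hM.lipschitz_scaled hL)
      (hM.support_scaled hL) (hu (Sum.inr (i, j, k))) k
    rw [Real.coe_toNNReal _ (by positivity)] at this
    calc _ ≤ _ := this
      _ ≤ (L ^ d)⁻¹ * (M * L⁻¹) * (2 * L * δ * V) := by
          gcongr
          exact hn
      _ = (L ^ d)⁻¹ * V * (2 * M) * δ := by field_simp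
      _ = _ := by rw [hVeq]
  rw [hdecomp]
  calc _ ≤ |∫ x, m₀ x * a x (GφL i x - Gφ i x) j ∂μ| + ∑ k, |∫ x, m₀ x * Gσ i j k x k ∂μ| :=
        (abs_add_le _ _).trans (by gcongr; exact Finset.abs_sum_le_sum_abs _ _)
    _ ≤ 2 ^ d * volume.real (cube d 1) * (2 * M * Real.sqrt (A + 1)) * δ
        + ∑ _k : Fin d, 2 ^ d * volume.real (cube d 1) * (2 * M) * δ := by
        gcongr with k
        exact hsecond k
    _ = _ := by
        simp
        ring

end Estimates

end DirichletProxy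

theorem lemma3 (d : ℕ) (hd : 2 ≤ d) (lam : ℝ) (hlam : 0 < lam) (β : ℝ) (hβ : β ∈ Set.Ioo (0 : ℝ) 1)
    (M : ℝ≥0) :
    ∃ C : ℝ, ∀ (a : Space d → Space d →L[ℝ] Space d)
      (ah : Space d →L[ℝ] Space d)
      (φ : Fin d → Space d → ℝ)
      (Gφ : Fin d → Space d → Space d)
      (σ : Fin d → Fin d → Fin d → Space d → ℝ)
      (Gσ : Fin d → Fin d → Fin d → Space d → Space d)
      (rs L : ℝ) (mask : Space d → ℝ)
      (φL : Fin d → Space d → ℝ)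
      (GφL : Fin d → Space d → Space d)
      (σL : Fin d → Fin d → Fin d → Space d → ℝ)
      (GσL : Fin d → Fin d → Fin d → Space d → Space d),
      IsCoeff lam a →
      IsCorrector a ah φ Gφ σ Gσ →
      0 < rs → rs ≤ L →
      IsMask M mask →
      IsProxy a L φL GφL σL GσL →
      -- sublinearity of `(φ, σ)` on `Q_{2L}`
      1 / (2 * L) * rms (cube d (2 * L))
          (centered (cube d (2 * L)) (joint φ σ))
        ≤ (rs / (2 * L)) ^ β →
      -- sublinearity of the proxy `(φL, σL)` on `Q_{2L}`
      1 / (2 * L) * rms (cube d (2 * L)) (joint φL σL)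
        ≤ (rs / (2 * L)) ^ β →
      rms (cube d (3 / 2 * L)) (fun i x => GφL i x - Gφ i x)
          ≤ C * (rs / L) ^ β ∧
      -- the gauge of `σ` is only needed here, and only for `d ≥ 3`
      ((3 ≤ d → SolvesGauge Set.univ (flux a Gφ) Gσ) →
        rms (cube d L)
            (fun (p : Fin d × Fin d × Fin d) x =>
              GσL p.1 p.2.1 p.2.2 x - Gσ p.1 p.2.1 p.2.2 x)
          ≤ C * (rs / L) ^ β) ∧
      ‖proxyTensor a L mask GφL - ah‖ ≤ C * (rs / L) ^ β := by
  obtain ⟨K₁, -, hcut₁⟩ := exists_cutoff d (by norm_num : (3 / 2 : ℝ) < 2)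
  obtain ⟨K₂, -, hcut₂⟩ := exists_cutoff d (by norm_num : (1 : ℝ) < 3 / 2)
  set A := 2 / lam * (4 / lam + 1) * (16 * K₁ ^ 2) with hA
  have hA0 : 0 ≤ A := by positivity
  set B := 160 * K₂ ^ 2 + 16 * A with hB
  set C₁ := Real.sqrt (d * (2 ^ d * A)) with hC₁
  set C₂ := Real.sqrt (d ^ 3 * (2 ^ d * B)) with hC₂
  set C₃ := (d : ℝ) ^ 2 * (2 ^ d * volume.real (cube d 1) * (2 * M * Real.sqrt (A + 1) + 2 * d * M))
    with hC₃
  have hC₁0 : 0 ≤ C₁ := Real.sqrt_nonneg _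
  have hC₂0 : 0 ≤ C₂ := Real.sqrt_nonneg _
  have hC₃0 : 0 ≤ C₃ := by positivity
  refine ⟨C₁ + C₂ + C₃, ?_⟩
  intro a ah φ Gφ σ Gσ rs L mask φL GφL σL GσL ha h hrs hrsL hM hL' h1 h2
  have hL : 0 < L := hrs.trans_le hrsL
  set δ := (rs / (2 * L)) ^ β with hδ
  have hδ0 : 0 < δ := by positivity
  have hδle : δ ≤ (rs / L) ^ β := by
    have := hβ.1.le
    rw [hδ]
    gcongr
    linarith
  have hφ (i) := integral_grad_phi_sub_sq_le hlam hL (hcut₁ L hL) ha h hL' h1 h2 i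
  rw [← hA] at hφ
  -- each constant may be enlarged to their sum
  have hbound {y c : ℝ} (hy : y ≤ c * δ) (hc : 0 ≤ c) (hle : c ≤ C₁ + C₂ + C₃) :
      y ≤ (C₁ + C₂ + C₃) * (rs / L) ^ β :=
    hy.trans (mul_le_mul hle hδle hδ0.le (hc.trans hle))
  have hvol {r D : ℝ} (hr : 1 ≤ r) (hD : 0 ≤ D) : D * δ ^ 2 * volume.real (cube d (2 * L))
      ≤ 2 ^ d * D * δ ^ 2 * volume.real (cube d (r * L)) := by
    calc _ ≤ D * δ ^ 2 * (2 ^ d * volume.real (cube d (r * L))) := by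
          gcongr
          exact volume_cube_two_mul_le hr hL
      _ = _ := by ring
  refine ⟨hbound (c := C₁) ?_ hC₁0 (by linarith), fun hg => hbound (c := C₂) ?_ hC₂0 (by linarith),
    hbound (c := C₃) ?_ hC₃0 (by linarith)⟩
  · refine rms_le (by positivity) (fun i => ?_) (by positivity)
      (fun i => (hφ i).trans (hvol (by norm_num) hA0)) (le_of_eq ?_)
    · exact ((hL'.h10_phi i).memLp_grad.mono_measure
        (Measure.restrict_mono (cube_subset (by linarith)) le_rfl)).sub
        ((h.h1_phi i).memLp_grad_cube _)
    · rw [mul_pow, hC₁, Real.sq_sqrt (by positivity), Fintype.card_fin]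
      ring
  · have hg' := h.solvesGauge hd hg
    have hσ (i j k) := integral_grad_sigma_sub_sq_le hlam hL (hcut₂ L hL) ha h hL' hg' h1 h2
      (hφ i) j k
    have hσ' (i j k) := (hσ i j k).trans (hvol le_rfl (by positivity))
    simp only [one_mul] at hσ'
    refine rms_le hL (fun p => ?_) (by positivity) (fun p => hσ' p.1 p.2.1 p.2.2) (le_of_eq ?_)
    · exact ((hL'.h10_sigma p.1 p.2.1 p.2.2).memLp_grad.mono_measure
        (Measure.restrict_mono (cube_subset (by linarith)) le_rfl)).sub
        ((h.h1_sigma p.1 p.2.1 p.2.2).memLp_grad_cube _)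
    · rw [mul_pow, hC₂, Real.sq_sqrt (by positivity), Fintype.card_prod, Fintype.card_prod,
        Fintype.card_fin]
      push_cast
      ring
  · refine (opNorm_le_of_unitVec (by positivity) fun i j =>
      abs_proxyTensor_sub_le hlam hL hδ0 hA0 ha h hL' hM h1 (hφ i) j).trans_eq ?_
    rw [hC₃]
    ring
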